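/- Let $\Omega\subset\mathbb R^2$ be a nonempty bounded open set and let $A=(a_{ij})_{i,j=1,2}$ be a matrix of bounded measurable real functions on $\Omega$ such that, for some constants $0<\lambda\le\Lambda$, $\lambda|\xi|^2\le a_{ij}(x)\xi_i\xi_j\le\Lambda|\xi|^2$ for all $x\in\Omega$ and $\xi\in\mathbb R^2$ (repeated indices are summed), $a_{ij}(x)=a_{ji}(x)$ and $\det A(x)=1$ for all $x\in\Omega$. Let $u\in H^1_{\mathrm{loc}}(\Omega)$ be a weak solution of $(a_{ij}u_{x_i})_{x_j}=0$ in $\Omega$, i.e. $\int_\Omega a_{ij}u_{x_i}\varphi_{x_j}\,dx=0$ for all $\varphi\in C_c^\infty(\Omega)$. Then the number $$S=\sup_{x_0\in\Omega}\ \operatorname*{ess\,sup}_{0<r<\mathrm{dist}(x_0,\partial\Omega)}\int_{|\xi|=1}a_{ij}(x_0+r\xi)\xi_i\xi_j\,d\sigma_\xi$$ is positive and finite, and $u$ is $\alpha$-Hölder continuous in $\Omega$ with $\alpha=2\pi/S$: after modification on a null set, $u$ satisfies, for every compact $K\subset\Omega$, $$\sup_{x,y\in K,\ x\ne y}\frac{|u(x)-u(y)|}{|x-y|^{\alpha}}<+\infty.$$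 -/

import Mathlib

open MeasureTheory
open scoped ContDiff ENNReal

noncomputable section

/-- The Euclidean plane. -/
abbrev Plane : Type := EuclideanSpace ℝ (Fin 2)

/-- Coefficient matrices `A = (a_ij)` on the plane (only the values on the domain matter). -/
abbrev CoeffField : Type := Plane → Matrix (Fin 2) (Fin 2) ℝ

/-- Smooth test functions, compactly supported in `Ω`. -/
structure IsTestFunction (Ω : Set Plane) (φ : Plane → ℝ) : Prop where
  smooth : ContDiff ℝ ∞ φ
  compact_support : HasCompactSupport φ
  support_subset : tsupport φ ⊆ Ω

/-- The classical partial derivative `∂φ/∂x_i` at `x`. -/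
def classicalPartial (i : Fin 2) (φ : Plane → ℝ) (x : Plane) : ℝ :=
  fderiv ℝ φ x (EuclideanSpace.single i 1)

/-- `f ∈ L²_loc(Ω)`. -/
def MemL2Loc (Ω : Set Plane) (f : Plane → ℝ) : Prop :=
  ∀ K : Set Plane, IsCompact K → K ⊆ Ω → MemLp f 2 (volume.restrict K)

/-- `Du = (u_{x_0}, u_{x_1})` is an `L²_loc` weak (distributional) gradient of `u` in `Ω`. -/
structure IsWeakGradient (Ω : Set Plane) (u : Plane → ℝ) (Du : Fin 2 → Plane → ℝ) : Prop where
  memL2Loc : ∀ i, MemL2Loc Ω (Du i)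
  integral_eq : ∀ i, ∀ φ : Plane → ℝ, IsTestFunction Ω φ →
    ∫ x in Ω, u x * classicalPartial i φ x = -∫ x in Ω, Du i x * φ x

/-- `u ∈ H¹_loc(Ω)` is a weak solution of `(a_ij u_{x_i})_{x_j} = 0` in `Ω`. -/
def IsWeakSolution (Ω : Set Plane) (A : CoeffField) (u : Plane → ℝ) : Prop :=
  MemL2Loc Ω u ∧ ∃ Du : Fin 2 → Plane → ℝ, IsWeakGradient Ω u Du ∧
    ∀ φ : Plane → ℝ, IsTestFunction Ω φ →
      ∫ x in Ω, ∑ i, ∑ j, A x i j * Du i x * classicalPartial j φ x = 0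

/-- The quadratic form `a_ij(x) ξ_i ξ_j`. -/
def quadForm (A : CoeffField) (x ξ : Plane) : ℝ :=
  ∑ i, ∑ j, A x i j * ξ i * ξ j

/-- The point `(cos θ, sin θ)` of the unit circle. -/
def circlePoint (θ : ℝ) : Plane := !₂[Real.cos θ, Real.sin θ]

/-- The integral `∫_{|ξ|=1} a_ij(x₀ + r ξ) ξ_i ξ_j dσ(ξ)` with respect to arc length, for a
nonnegative quadratic form. -/
def circleIntegralForm (A : CoeffField) (x₀ : Plane) (r : ℝ) : ℝ≥0∞ :=
  ∫⁻ θ in Set.Ioc 0 (2 * Real.pi),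
    ENNReal.ofReal (quadForm A (x₀ + r • circlePoint θ) (circlePoint θ))

/-- The supremum over centres `x₀ ∈ Ω` of the essential supremum over radii
`0 < r < dist(x₀, ∂Ω)` of the circle integrals. -/
def supCircleIntegral (Ω : Set Plane) (A : CoeffField) : ℝ≥0∞ :=
  ⨆ x₀ ∈ Ω, essSup (fun r : ℝ => circleIntegralForm A x₀ r)
    (volume.restrict (Set.Ioo 0 (Metric.infDist x₀ (frontier Ω))))

/-- The exponent `α`. -/
def holderExponent (Ω : Set Plane) (A : CoeffField) : ℝ :=
  2 * Real.pi * (supCircleIntegral Ω A).toReal⁻¹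

/-- `α`-Hölder continuity in `Ω`, on compact subsets, of a function defined up to null sets: one
representative of `u` satisfies the Hölder estimate on every compact subset of `Ω`. -/
def IsLocallyHolder (Ω : Set Plane) (α : ℝ) (u : Plane → ℝ) : Prop :=
  ∃ v : Plane → ℝ, v =ᵐ[volume.restrict Ω] u ∧
    ∀ K : Set Plane, IsCompact K → K ⊆ Ω →
      ∃ C : ℝ, ∀ x ∈ K, ∀ y ∈ K, |v x - v y| ≤ C * dist x y ^ α

end

open MeasureTheory
open scoped ContDiff ENNReal

noncomputable section

/-! The key is a decay estimate for the energy $E(r)=\int_{B_r(x_0)} a_{ij}u_{x_i}u_{x_j}$ with an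
exponent read off from the coefficients. Formally, let $\nu$ be the outward normal on a circle of
radius $r$, $a=a_{ij}\nu_i\nu_j$, $f=a_{ij}u_{x_i}\nu_j$ the flux and $T$ the tangential derivative
of $u$. The divergence theorem gives $E(r)=\int f u$ over the circle, and $\int f=0$, so a constant
may be subtracted from $u$. Young's inequality and the Wirtinger inequality with weight $a$
(`weighted_wirtinger_periodic`), whose sharp constant is $2\pi$ divided by the integral of $a$ over
the unit circle, bound this by $\frac{S}{4\pi}\,r\int (T^2+f^2)/a$. Since $A$ is symmetric with
determinant $1$, $T^2+f^2$ is exactly $a$ times the energy density (`sq_tangential_add_sq_flux`).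
Hence $E\le\frac{S}{4\pi}\,rE'$, so $r^{-4\pi/S}E(r)$ is nondecreasing.

To avoid traces of $u$ on circles, the inequality is proved with the flux of $u$ paired with a
smooth function $w$ (`ae_flux_eq`, `ae_setIntegral_flux_le`), multiplied by a radial weight and
integrated in $r$. Letting $w$ run through smooth $H^1$ approximations of $u$ gives
`setIntegral_primitive_mul_energyDensity_le`, and a power weight turns that into the decay
`setIntegral_energyDensity_le_rpow`, with no differentiation of $E$.

By ellipticity, the $L^2$ norm of the gradient on discs of radius $t$ is $O(t^{2\pi/S})$, uniformly
for nearby centres because $S$ is a supremum over centres. In dimension two this is Morrey's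
condition for the exponent $\alpha=2\pi/S$: `exists_null_abs_sub_le` gives the Hölder bound locally
off a null set, and `isLocallyHolder_of_local_bounds` produces one continuous representative and
passes to compact sets. Positivity and finiteness of $S$ come from $2\pi\lambda\le S\le
2\pi\Lambda$. -/

/-! ### Weighted Wirtinger inequality -/

open Set in
theorem intervalIntegrable_inv_of_bounds {a : ℝ → ℝ} {p q lam Lam : ℝ} (hlam : 0 < lam)
    (ha : IntervalIntegrable a volume p q) (hb : ∀ t, lam ≤ a t ∧ a t ≤ Lam) :
    IntervalIntegrable (fun t => (a t)⁻¹) volume p q := by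
  refine (intervalIntegrable_const (c := lam⁻¹)).mono_fun ?_ ?_
  · exact (ha.def'.1.aemeasurable.inv).aestronglyMeasurable
  · refine Filter.Eventually.of_forall fun t => ?_
    have h1 := (hb t).1
    have h2 : 0 < a t := hlam.trans_le h1
    simp only [Real.norm_eq_abs, abs_inv, abs_of_pos h2, abs_of_pos hlam]
    exact inv_anti₀ hlam h1

-- A Riccati argument. With $\theta'=ka$, the derivative of $-k\tan\theta\,y^2$ equals
-- $y'^2/a-k^2ay^2$ minus the nonnegative term $(y'+ka\tan\theta\,y)^2/a$; its integral vanishes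
-- because $y$ does at both ends. Strictness of $k\int a<\pi$ keeps $\tan\theta$ bounded up to the
-- endpoints.
open Set in
theorem weighted_wirtinger_of_lt {a y : ℝ → ℝ} {p q lam Lam k : ℝ} (hpq : p ≤ q)
    (hlam : 0 < lam) (ha : IntervalIntegrable a volume p q) (hb : ∀ t, lam ≤ a t ∧ a t ≤ Lam)
    (hy : ContDiff ℝ 1 y) (hp : y p = 0) (hq : y q = 0) (hk : 0 < k)
    (hkl : k * (∫ t in p..q, a t) < Real.pi) :
    k ^ 2 * (∫ t in p..q, a t * y t ^ 2) ≤ ∫ t in p..q, deriv y t ^ 2 * (a t)⁻¹ := by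
  set l := ∫ t in p..q, a t with hl
  have hapos : ∀ t, 0 < a t := fun t => hlam.trans_le (hb t).1
  set s : ℝ → ℝ := fun t => ∫ x in p..t, a x with hs
  have haI : ∀ {u v}, u ∈ Icc p q → v ∈ Icc p q → IntervalIntegrable a volume u v := by
    intro u v hu hv
    refine ha.mono_set ?_
    rw [uIcc_of_le hpq]
    exact uIcc_subset_Icc hu hv
  have hsub : ∀ {u v}, u ∈ Icc p q → v ∈ Icc p q → s v - s u = ∫ x in u..v, a x := by
    intro u v hu hv
    simp only [hs]
    rw [intervalIntegral.integral_interval_sub_left (haI ⟨le_rfl, hpq⟩ hv) (haI ⟨le_rfl, hpq⟩ hu)]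
  have hs0 : ∀ t ∈ Icc p q, 0 ≤ s t := fun t ht =>
    intervalIntegral.integral_nonneg ht.1 fun x _ => (hapos x).le
  have hsl : ∀ t ∈ Icc p q, s t ≤ l := by
    intro t ht
    have := hsub ht (right_mem_Icc.2 hpq)
    have h2 : 0 ≤ ∫ x in t..q, a x := intervalIntegral.integral_nonneg ht.2 fun x _ => (hapos x).le
    have h3 : s q = l := rfl
    linarith
  -- Centring at `l / 2` makes the range of `θ` lie in $[-kl/2,kl/2]$, a compact subset of
  -- $(-\pi/2,\pi/2)$.
  set θ : ℝ → ℝ := fun t => k * (s t - l / 2) with hθ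
  have hmaps : MapsTo θ (Icc p q) (Icc (-(k * l / 2)) (k * l / 2)) := by
    intro t ht
    have h1 := mul_le_mul_of_nonneg_left (hs0 t ht) hk.le
    have h2 := mul_le_mul_of_nonneg_left (hsl t ht) hk.le
    constructor <;> simp only [hθ] <;> nlinarith
  have hcos : ∀ x ∈ Icc (-(k * l / 2)) (k * l / 2), Real.cos x ≠ 0 := fun x hx =>
    (Real.cos_pos_of_mem_Ioo ⟨by linarith [hx.1], by linarith [hx.2]⟩).ne'
  have htanLip : ∃ K, LipschitzOnWith K Real.tan (Icc (-(k * l / 2)) (k * l / 2)) := by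
    refine ContDiffOn.exists_lipschitzOnWith (n := 1) (fun x hx => ?_) (by norm_num)
      (convex_Icc _ _) isCompact_Icc
    exact (Real.contDiffAt_tan.2 (hcos x hx)).contDiffWithinAt
  obtain ⟨K, hK⟩ := htanLip
  have hLam : 0 ≤ Lam := (hapos 0).le.trans (hb 0).2
  have hθLip : LipschitzOnWith (k * Lam).toNNReal θ (Icc p q) := by
    refine LipschitzOnWith.of_dist_le_mul fun u hu v hv => ?_
    rw [Real.dist_eq, Real.dist_eq, Real.coe_toNNReal _ (by positivity)]
    have e : θ u - θ v = k * (s u - s v) := by simp only [hθ]; ring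
    rw [e, hsub hv hu, abs_mul, abs_of_pos hk, mul_assoc]
    refine mul_le_mul_of_nonneg_left ?_ hk.le
    refine intervalIntegral.norm_integral_le_of_norm_le_const (f := a) fun x _ => ?_
    rw [Real.norm_eq_abs, abs_of_pos (hapos x)]
    exact (hb x).2
  have hAC1 : AbsolutelyContinuousOnInterval (fun t => Real.tan (θ t)) p q := by
    have := (hK.comp hθLip hmaps)
    rw [← uIcc_of_le hpq] at this
    exact this.absolutelyContinuousOnInterval
  have hAC2 : AbsolutelyContinuousOnInterval (fun t => y t ^ 2) p q :=
    ContDiffOn.absolutelyContinuousOnInterval ((hy.pow 2).contDiffOn)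
  -- The weight is only measurable, so `θ` is differentiable only almost everywhere; absolute
  -- continuity is what allows the fundamental theorem of calculus.
  have hAC : AbsolutelyContinuousOnInterval (fun t => -k * (Real.tan (θ t) * y t ^ 2)) p q :=
    (hAC1.fun_mul hAC2).const_mul (-k)
  have hint := hAC.integral_deriv_eq_sub
  rw [hp, hq] at hint
  have hder : ∀ᵐ t : ℝ, t ∈ Icc p q → deriv (fun t => -k * (Real.tan (θ t) * y t ^ 2)) t
      ≤ deriv y t ^ 2 * (a t)⁻¹ - k ^ 2 * (a t * y t ^ 2) := by
    filter_upwards [ha.ae_hasDerivAt_integral] with t ht hmem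
    have h1 : HasDerivAt s (a t) t := ht (by rwa [uIcc_of_le hpq]) p (by simp)
    have h2 : HasDerivAt θ (k * a t) t := (h1.sub_const (l / 2)).const_mul k
    have hc := hcos _ (hmaps hmem)
    have h3 := (Real.hasDerivAt_tan hc).comp t h2
    have h4 : HasDerivAt y (deriv y t) t := (hy.differentiable (by norm_num) t).hasDerivAt
    have h5 := ((h3.fun_mul (h4.fun_pow 2)).const_mul (-k))
    have h6 := h5.deriv
    simp only [Function.comp_def] at h6
    rw [h6]
    have e1 : 1 / Real.cos (θ t) ^ 2 = 1 + Real.tan (θ t) ^ 2 := by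
      rw [Real.tan_eq_sin_div_cos]
      field_simp
      linarith [Real.sin_sq_add_cos_sq (θ t)]
    rw [e1]
    have hat := hapos t
    have key : 0 ≤ (deriv y t + a t * k * Real.tan (θ t) * y t) ^ 2 * (a t)⁻¹ := by positivity
    have e2 : (deriv y t + a t * k * Real.tan (θ t) * y t) ^ 2 * (a t)⁻¹
        = deriv y t ^ 2 * (a t)⁻¹ + 2 * k * Real.tan (θ t) * y t * deriv y t
          + a t * k ^ 2 * Real.tan (θ t) ^ 2 * y t ^ 2 := by
      field_simp
      ring
    rw [e2] at key
    simp only [Nat.cast_ofNat, Nat.add_one_sub_one, pow_one]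
    nlinarith [key]
  have hyc : Continuous y := hy.continuous
  have hy'c : Continuous (deriv y) := hy.continuous_deriv le_rfl
  have hI1 : IntervalIntegrable (fun t => deriv y t ^ 2 * (a t)⁻¹) volume p q :=
    (intervalIntegrable_inv_of_bounds hlam ha hb).continuousOn_mul (by fun_prop)
  have hI2 : IntervalIntegrable (fun t => a t * y t ^ 2) volume p q :=
    ha.mul_continuousOn (by fun_prop)
  have hmono := intervalIntegral.integral_mono_ae_restrict hpq hAC.intervalIntegrable_deriv
    (hI1.sub (hI2.const_mul (k ^ 2)))
    ((ae_restrict_iff' measurableSet_Icc).2 hder)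
  rw [hint, intervalIntegral.integral_sub hI1 (hI2.const_mul (k ^ 2)),
    intervalIntegral.integral_const_mul] at hmono
  linarith

/-- The endpoint $k=\pi/l$ is reached as a limit from below, both sides being continuous in $k$. -/
theorem weighted_wirtinger_interval {a y : ℝ → ℝ} {p q lam Lam : ℝ} (hpq : p < q)
    (hlam : 0 < lam) (ha : IntervalIntegrable a volume p q) (hb : ∀ t, lam ≤ a t ∧ a t ≤ Lam)
    (hy : ContDiff ℝ 1 y) (hp : y p = 0) (hq : y q = 0) :
    (Real.pi / ∫ t in p..q, a t) ^ 2 * (∫ t in p..q, a t * y t ^ 2)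
      ≤ ∫ t in p..q, deriv y t ^ 2 * (a t)⁻¹ := by
  have hl : 0 < ∫ t in p..q, a t :=
    intervalIntegral.intervalIntegral_pos_of_pos ha (fun x => hlam.trans_le (hb x).1) hpq
  set l := ∫ t in p..q, a t
  have hm : 0 < Real.pi / l := by positivity
  have hcont : Continuous fun k : ℝ => k ^ 2 * (∫ t in p..q, a t * y t ^ 2) := by fun_prop
  refine le_of_tendsto (hcont.continuousAt.tendsto.mono_left
    (nhdsWithin_le_nhds (s := Set.Iio (Real.pi / l)))) ?_
  filter_upwards [Ioo_mem_nhdsLT hm] with k hk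
  exact weighted_wirtinger_of_lt hpq.le hlam ha hb hy hp hq hk.1 ((lt_div_iff₀ hl).1 hk.2)

/-- Weighted Wirtinger inequality on the circle. -/
theorem weighted_wirtinger_periodic {a y : ℝ → ℝ} {lam Lam T : ℝ} (hT : 0 < T)
    (hlam : 0 < lam) (ha : IntervalIntegrable a volume 0 T) (hb : ∀ t, lam ≤ a t ∧ a t ≤ Lam)
    (hap : Function.Periodic a T) (hy : ContDiff ℝ 1 y) (hyp : Function.Periodic y T) :
    ∃ c, (2 * Real.pi / ∫ t in 0..T, a t) ^ 2 * (∫ t in 0..T, a t * (y t - c) ^ 2)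
      ≤ ∫ t in 0..T, deriv y t ^ 2 * (a t)⁻¹ := by
  have haI : ∀ u v, IntervalIntegrable a volume u v := fun u v =>
    hap.intervalIntegrable₀ hT.ne' ha u v
  have hapos : ∀ t, 0 < a t := fun t => hlam.trans_le (hb t).1
  have hL : 0 < ∫ t in 0..T, a t :=
    intervalIntegral.intervalIntegral_pos_of_pos ha hapos hT
  set L := ∫ t in 0..T, a t with hLdef
  set s : ℝ → ℝ := fun t => ∫ x in 0..t, a x with hs
  have hsub : ∀ u v, s v - s u = ∫ x in u..v, a x := fun u v =>
    intervalIntegral.integral_interval_sub_left (haI _ _) (haI _ _)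
  have hsmono : StrictMono s := by
    intro u v huv
    have := intervalIntegral.intervalIntegral_pos_of_pos (haI u v) hapos huv
    linarith [hsub u v]
  have hscont : Continuous s := intervalIntegral.continuous_primitive (fun u v => haI u v) 0
  have hsT : ∀ t, s (t + T) = s t + L := by
    intro t
    have := hsub t (t + T)
    rw [hap.intervalIntegral_add_eq t 0, zero_add] at this
    linarith
  have hlow : ∀ t, 0 ≤ t → lam * t ≤ s t := by
    intro t ht
    have := intervalIntegral.integral_mono_on ht (intervalIntegrable_const (c := lam)) (haI 0 t)
      (fun x _ => (hb x).1)
    simpa [mul_comm] using this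
  have hlow' : ∀ t, t ≤ 0 → s t ≤ lam * t := by
    intro t ht
    have := intervalIntegral.integral_mono_on ht (intervalIntegrable_const (c := lam)) (haI t 0)
      (fun x _ => (hb x).1)
    have h0 : s 0 = 0 := by simp [hs]
    have := hsub t 0
    simp only [intervalIntegral.integral_const, zero_sub, smul_eq_mul] at *
    linarith
  have hsurj : Function.Surjective s := by
    refine hscont.surjective ?_ ?_
    · refine Filter.tendsto_atTop_mono' _ ?_ (Filter.tendsto_id.const_mul_atTop hlam)
      filter_upwards [Filter.eventually_ge_atTop 0] with t ht using hlow t ht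
    · refine Filter.tendsto_atBot_mono' _ ?_ (Filter.tendsto_id.const_mul_atBot hlam)
      filter_upwards [Filter.eventually_le_atBot 0] with t ht using hlow' t ht
  set e := hsmono.orderIsoOfSurjective s hsurj with he
  have hes : ∀ t, e t = s t := fun t => rfl
  -- In the variable `s`, the weighted arc length, the period becomes `L`.
  set z : ℝ → ℝ := fun x => y (e.symm x) with hz
  have hzc : Continuous z := hy.continuous.comp e.symm.continuous
  have hzper : ∀ x, z (x + L) = z x := by
    intro x
    have : e.symm (x + L) = e.symm x + T := by
      rw [OrderIso.symm_apply_eq, hes, hsT, ← hes, OrderIso.apply_symm_apply]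
    simp only [hz, this]
    exact hyp _
  -- The difference `z (x + L / 2) - z x` changes sign over half a period, so it vanishes somewhere.
  -- This gives two points with equal values of `y` that cut the circle into arcs of weighted length
  -- `L / 2`. That common value is the constant `c`, and each arc contributes the interval
  -- inequality with constant $\pi/(L/2)$.
  obtain ⟨x0, hx0⟩ : ∃ x0, z (x0 + L / 2) - z x0 = 0 := by
    have hc : Continuous fun x => z (x + L / 2) - z x := by fun_prop
    have h1 : z (L / 2 + L / 2) - z (L / 2) = -(z (0 + L / 2) - z 0) := by
      have := hzper 0
      rw [zero_add] at this
      rw [add_halves, this, zero_add]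
      ring
    rcases le_total 0 (z (0 + L / 2) - z 0) with h | h
    · exact mem_range_of_exists_le_of_exists_ge hc ⟨L / 2, by rw [h1]; linarith⟩ ⟨0, h⟩
    · exact mem_range_of_exists_le_of_exists_ge hc ⟨0, h⟩ ⟨L / 2, by rw [h1]; linarith⟩
  set t0 := e.symm x0
  set t1 := e.symm (x0 + L / 2)
  have hst0 : s t0 = x0 := by rw [← hes]; exact e.apply_symm_apply x0
  have hst1 : s t1 = x0 + L / 2 := by rw [← hes]; exact e.apply_symm_apply _
  have ht01 : t0 < t1 := hsmono.lt_iff_lt.1 (by rw [hst0, hst1]; linarith)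
  have ht1T : t1 < t0 + T := hsmono.lt_iff_lt.1 (by rw [hsT, hst0, hst1]; linarith)
  have hyt : y t1 = y t0 := by
    have : z (x0 + L / 2) = z x0 := by linarith
    exact this
  have hI1 : ∫ t in t0..t1, a t = L / 2 := by rw [← hsub]; linarith
  have hI2 : ∫ t in t1..(t0 + T), a t = L / 2 := by rw [← hsub, hsT]; linarith
  refine ⟨y t0, ?_⟩
  have hyc : ContDiff ℝ 1 fun t => y t - y t0 := hy.sub contDiff_const
  have hd : deriv (fun t => y t - y t0) = deriv y := by
    ext t
    simp
  have w1 := weighted_wirtinger_interval ht01 hlam (haI _ _) hb hyc (by simp)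
    (by simp [hyt])
  have w2 := weighted_wirtinger_interval ht1T hlam (haI _ _) hb hyc (by simp [hyt])
    (by simp [hyp t0])
  rw [hI1, hd] at w1
  rw [hI2, hd] at w2
  have hy'c : Continuous (deriv y) := hy.continuous_deriv le_rfl
  have hJ1 : ∀ u v, IntervalIntegrable (fun t => deriv y t ^ 2 * (a t)⁻¹) volume u v := fun u v =>
    (intervalIntegrable_inv_of_bounds hlam (haI u v) hb).continuousOn_mul (by fun_prop)
  have hyct := hy.continuous
  have hJ2 : ∀ u v, IntervalIntegrable (fun t => a t * (y t - y t0) ^ 2) volume u v := fun u v =>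
    (haI u v).mul_continuousOn (by fun_prop)
  have hy'p : Function.Periodic (deriv y) T := by
    intro t
    rw [← deriv_comp_add_const]
    exact congrArg (fun f => deriv f t) (funext hyp)
  have hP1 : Function.Periodic (fun t => deriv y t ^ 2 * (a t)⁻¹) T := fun t => by
    simp only [hy'p t, hap t]
  have hP2 : Function.Periodic (fun t => a t * (y t - y t0) ^ 2) T := fun t => by
    simp only [hyp t, hap t]
  have q1 := hP1.intervalIntegral_add_eq t0 0
  have q2 := hP2.intervalIntegral_add_eq t0 0
  rw [zero_add] at q1 q2
  rw [← q1, ← q2, ← intervalIntegral.integral_add_adjacent_intervals (hJ1 t0 t1) (hJ1 t1 _),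
    ← intervalIntegral.integral_add_adjacent_intervals (hJ2 t0 t1) (hJ2 t1 _)]
  have e3 : Real.pi / (L / 2) = 2 * Real.pi / L := by field_simp
  rw [e3] at w1 w2
  linarith

/-! ### Polar coordinates on discs -/

-- Reconciles the angular range $(-\pi,\pi)$ of `polarCoord` with the range $(0,2\pi]$ of the circle
-- integrals: both are fundamental domains for translation by $2\pi$.
open Set in
theorem setLIntegral_Ioo_eq_Ioc_of_periodic {f : ℝ → ℝ≥0∞} (hf : Function.Periodic f (2 * Real.pi)) :
    ∫⁻ t in Ioo (-Real.pi) Real.pi, f t = ∫⁻ t in Ioc 0 (2 * Real.pi), f t := by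
  rw [setLIntegral_congr Ioo_ae_eq_Ioc]
  have h1 := isAddFundamentalDomain_Ioc Real.two_pi_pos (-Real.pi) volume
  have h2 := isAddFundamentalDomain_Ioc Real.two_pi_pos 0 volume
  have := h1.setLIntegral_eq h2 f hf.map_vadd_zmultiples
  rw [zero_add] at this
  rw [← this]
  congr 3
  ring

theorem circlePoint_apply_zero (θ : ℝ) : circlePoint θ 0 = Real.cos θ := by simp [circlePoint]

theorem circlePoint_apply_one (θ : ℝ) : circlePoint θ 1 = Real.sin θ := by simp [circlePoint]

theorem circlePoint_periodic : Function.Periodic circlePoint (2 * Real.pi) := fun θ => by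
  simp [circlePoint]

theorem norm_circlePoint (θ : ℝ) : ‖circlePoint θ‖ = 1 := by
  simp [EuclideanSpace.norm_eq, circlePoint]

theorem contDiff_circlePoint {n : WithTop ℕ∞} : ContDiff ℝ n circlePoint := by
  rw [contDiff_euclidean]
  intro i
  fin_cases i
  · simpa [circlePoint] using Real.contDiff_cos
  · simpa [circlePoint] using Real.contDiff_sin

theorem continuous_circlePoint : Continuous circlePoint := contDiff_circlePoint (n := 0).continuous

open Set in
theorem lintegral_eq_lintegral_polar (x₀ : Plane) {f : Plane → ℝ≥0∞} (hf : Measurable f) :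
    ∫⁻ x, f x = ∫⁻ r in Ioi 0, ∫⁻ θ in Ioc 0 (2 * Real.pi),
      ENNReal.ofReal r * f (x₀ + r • circlePoint θ) := by
  have hmp := (PiLp.volume_preserving_toLp (Fin 2)).comp
    (volume_preserving_finTwoArrow ℝ).symm
  have hmeas : Measurable fun p : ℝ × ℝ => x₀ + p.1 • circlePoint p.2 :=
    (continuous_const.add (continuous_fst.smul
      (continuous_circlePoint.comp continuous_snd))).measurable
  rw [← lintegral_add_left_eq_self f x₀, ← hmp.lintegral_comp (by fun_prop),
    ← lintegral_comp_polarCoord_symm, polarCoord_target, Measure.volume_eq_prod,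
    ← Measure.prod_restrict, lintegral_prod]
  · refine lintegral_congr fun r => ?_
    rw [← setLIntegral_Ioo_eq_Ioc_of_periodic]
    · refine lintegral_congr fun θ => ?_
      rw [smul_eq_mul]
      congr 3
      ext i
      fin_cases i <;> simp [polarCoord_symm_apply, circlePoint, MeasurableEquiv.finTwoArrow]
    · intro θ
      simp only [circlePoint_periodic θ]
  · simp only [smul_eq_mul]
    refine Measurable.aemeasurable ?_
    refine (by fun_prop : Measurable fun p : ℝ × ℝ => ENNReal.ofReal p.1).mul ?_
    refine hf.comp (measurable_const.add (hmp.measurable.comp ?_))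
    exact continuous_polarCoord_symm.measurable

/-- The measure `r dr dθ` on `(0, R) × (0, 2π]`. -/
def polarMeasure (R : ℝ) : Measure (ℝ × ℝ) :=
  ((volume.restrict (Set.Ioo 0 R)).withDensity fun r => ENNReal.ofReal r).prod
    (volume.restrict (Set.Ioc 0 (2 * Real.pi)))

-- Stating the change of variables as measure preservation lets measurability, integrability and
-- Fubini pass from a disc to almost every circle, which is the only sense in which measurable
-- coefficients restrict to circles.
open Set in
theorem measurePreserving_polar (x₀ : Plane) (R : ℝ) :
    MeasurePreserving (fun p : ℝ × ℝ => x₀ + p.1 • circlePoint p.2) (polarMeasure R)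
      (volume.restrict (Metric.ball x₀ R)) := by
  have hmeas : Measurable fun p : ℝ × ℝ => x₀ + p.1 • circlePoint p.2 :=
    (continuous_const.add (continuous_fst.smul
      (continuous_circlePoint.comp continuous_snd))).measurable
  refine ⟨hmeas, ?_⟩
  ext s hs
  have hs' : MeasurableSet (s ∩ Metric.ball x₀ R) := hs.inter measurableSet_ball
  rw [Measure.map_apply hmeas hs, Measure.restrict_apply hs, polarMeasure,
    Measure.prod_apply (hmeas hs), ← lintegral_indicator_one hs',
    lintegral_eq_lintegral_polar x₀ (measurable_one.indicator hs'),
    lintegral_withDensity_eq_lintegral_mul _ (by fun_prop) (measurable_measure_prodMk_left (hmeas hs)),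
    ← lintegral_indicator measurableSet_Ioo, ← lintegral_indicator measurableSet_Ioi]
  refine lintegral_congr fun r => ?_
  by_cases hr : 0 < r
  · rw [indicator_of_mem (mem_Ioi.2 hr), lintegral_const_mul]
    · by_cases hR : r < R
      · rw [indicator_of_mem (mem_Ioo.2 ⟨hr, hR⟩), Pi.mul_apply]
        congr 1
        rw [← lintegral_indicator_one (measurable_prodMk_left (hmeas hs))]
        refine lintegral_congr fun θ => ?_
        have : x₀ + r • circlePoint θ ∈ Metric.ball x₀ R := by
          simp [norm_smul, norm_circlePoint, abs_of_pos hr, hR]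
        by_cases hx : x₀ + r • circlePoint θ ∈ s
        · rw [indicator_of_mem (show _ ∈ s ∩ Metric.ball x₀ R from ⟨hx, this⟩), indicator_of_mem]
          · rfl
          · exact hx
        · rw [indicator_of_notMem (s := s ∩ Metric.ball x₀ R) (fun h => hx h.1), indicator_of_notMem]
          exact hx
      · rw [indicator_of_notMem (fun h => hR h.2)]
        have : ∀ θ, (s ∩ Metric.ball x₀ R).indicator (1 : Plane → ℝ≥0∞)
            (x₀ + r • circlePoint θ) = 0 := by
          intro θ
          refine indicator_of_notMem (fun h => hR ?_) _
          simpa [norm_smul, norm_circlePoint, abs_of_pos hr] using h.2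
        simp [this]
    · exact (measurable_one.indicator hs').comp (hmeas.comp measurable_prodMk_left)
  · rw [indicator_of_notMem (fun h => hr h.1), indicator_of_notMem (s := Ioi 0) (fun h => hr h)]

open Set in
theorem ae_aestronglyMeasurable_polar {x₀ : Plane} {R : ℝ} {f : Plane → ℝ}
    (h : AEStronglyMeasurable f (volume.restrict (Metric.ball x₀ R))) :
    ∀ᵐ r ∂volume.restrict (Ioo 0 R), AEStronglyMeasurable
      (fun θ => f (x₀ + r • circlePoint θ)) (volume.restrict (Ioc 0 (2 * Real.pi))) := by
  have h1 := h.comp_measurePreserving (measurePreserving_polar x₀ R)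
  have h2 := h1.prodMk_left
  -- The density $r$ is positive on $(0,R)$, so a property valid almost everywhere for $r\,dr$ is
  -- valid for Lebesgue almost every radius.
  rw [ae_withDensity_iff (by fun_prop)] at h2
  filter_upwards [h2, ae_restrict_mem measurableSet_Ioo] with r hr hr0
  exact hr (by simpa using hr0.1)

open Set in
theorem ae_integrable_polar {x₀ : Plane} {R : ℝ} {f : Plane → ℝ}
    (h : IntegrableOn f (Metric.ball x₀ R)) :
    ∀ᵐ r ∂volume.restrict (Ioo 0 R), IntegrableOn
      (fun θ => f (x₀ + r • circlePoint θ)) (Ioc 0 (2 * Real.pi)) := by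
  have h1 : Integrable (fun p : ℝ × ℝ => f (x₀ + p.1 • circlePoint p.2)) (polarMeasure R) :=
    (measurePreserving_polar x₀ R).integrable_comp_of_integrable h
  have h2 := h1.prod_right_ae
  rw [ae_withDensity_iff (by fun_prop)] at h2
  filter_upwards [h2, ae_restrict_mem measurableSet_Ioo] with r hr hr0
  exact hr (by simpa using hr0.1)

open Set in
theorem integrableOn_polar {x₀ : Plane} {R : ℝ} {f : Plane → ℝ}
    (h : IntegrableOn f (Metric.ball x₀ R)) :
    IntegrableOn (fun r => r * ∫ θ in Ioc 0 (2 * Real.pi), f (x₀ + r • circlePoint θ))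
      (Ioo 0 R) := by
  have h1 : Integrable (fun p : ℝ × ℝ => f (x₀ + p.1 • circlePoint p.2)) (polarMeasure R) :=
    (measurePreserving_polar x₀ R).integrable_comp_of_integrable h
  have h2 := h1.integral_prod_left
  rw [integrable_withDensity_iff (by fun_prop) (by simp)] at h2
  refine h2.congr ?_
  filter_upwards [ae_restrict_mem measurableSet_Ioo] with r hr
  rw [ENNReal.toReal_ofReal hr.1.le, mul_comm]

open Set in
theorem setIntegral_ball_eq_polar {x₀ : Plane} {R : ℝ} {f : Plane → ℝ}
    (h : IntegrableOn f (Metric.ball x₀ R)) :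
    ∫ x in Metric.ball x₀ R, f x = ∫ r in Ioo 0 R,
      r * ∫ θ in Ioc 0 (2 * Real.pi), f (x₀ + r • circlePoint θ) := by
  have hmp := measurePreserving_polar x₀ R
  have h1 : Integrable (fun p : ℝ × ℝ => f (x₀ + p.1 • circlePoint p.2)) (polarMeasure R) :=
    hmp.integrable_comp_of_integrable h
  have h0 : ∫ x in Metric.ball x₀ R, f x
      = ∫ p, f (x₀ + p.1 • circlePoint p.2) ∂polarMeasure R := by
    conv_lhs => rw [← hmp.map_eq]
    refine integral_map hmp.measurable.aemeasurable ?_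
    rw [hmp.map_eq]
    exact h.aestronglyMeasurable
  rw [h0, polarMeasure, integral_prod _ h1,
    integral_withDensity_eq_integral_toReal_smul (by fun_prop) (by simp)]
  refine setIntegral_congr_fun measurableSet_Ioo fun r hr => ?_
  simp only [ENNReal.toReal_ofReal hr.1.le, smul_eq_mul]

/-! ### Layer-cake formula for radial primitives -/

/-- Fubini on the region $|x-x_0|<r$ underlies the layer-cake formula: integrating in $r$ first
produces the primitive of `g`, integrating in $x$ first produces the integral of `k` over a disc. -/
theorem integrable_indicator_radial_lt_mul {x₀ : Plane} {R : ℝ} {k : Plane → ℝ} {g : ℝ → ℝ}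
    (hk : IntegrableOn k (Metric.ball x₀ R)) (hg : IntegrableOn g (Set.Ioo 0 R)) :
    Integrable ({p : Plane × ℝ | ‖p.1 - x₀‖ < p.2}.indicator fun p => k p.1 * g p.2)
      ((volume.restrict (Metric.ball x₀ R)).prod (volume.restrict (Set.Ioo 0 R))) :=
  (hk.mul_prod hg).indicator (measurableSet_lt (by fun_prop) (by fun_prop))

theorem setIntegral_indicator_radial_lt {x₀ : Plane} {R r : ℝ} (k : Plane → ℝ) (g : ℝ → ℝ)
    (hr : r ≤ R) :
    ∫ x in Metric.ball x₀ R,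
      {p : Plane × ℝ | ‖p.1 - x₀‖ < p.2}.indicator (fun p => k p.1 * g p.2) (x, r)
      = g r * ∫ x in Metric.ball x₀ r, k x := by
  rw [← integral_const_mul, ← integral_indicator measurableSet_ball,
    ← integral_indicator measurableSet_ball]
  refine integral_congr_ae (Filter.Eventually.of_forall fun x => ?_)
  have hx : x ∈ Metric.ball x₀ r ↔ ‖x - x₀‖ < r := by rw [Metric.mem_ball, dist_eq_norm]
  have hx2 : x ∈ Metric.ball x₀ R ↔ ‖x - x₀‖ < R := by rw [Metric.mem_ball, dist_eq_norm]
  simp only [Set.indicator, hx, hx2, Set.mem_ofPred_eq]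
  split_ifs <;> first | rfl | (exfalso; linarith) | ring

theorem integrableOn_mul_setIntegral_ball {x₀ : Plane} {R : ℝ} {k : Plane → ℝ} {g : ℝ → ℝ}
    (hk : IntegrableOn k (Metric.ball x₀ R)) (hg : IntegrableOn g (Set.Ioo 0 R)) :
    IntegrableOn (fun r => g r * ∫ x in Metric.ball x₀ r, k x) (Set.Ioo 0 R) := by
  refine (integrable_indicator_radial_lt_mul hk hg).integral_prod_right.congr ?_
  filter_upwards [ae_restrict_mem measurableSet_Ioo] with r hr
  exact setIntegral_indicator_radial_lt k g hr.2.le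

/-- Layer-cake formula for a radial primitive against an integrable function on a disc. -/
theorem setIntegral_radial_primitive_mul {x₀ : Plane} {R : ℝ} {k : Plane → ℝ} {g : ℝ → ℝ}
    (hk : IntegrableOn k (Metric.ball x₀ R)) (hg : IntegrableOn g (Set.Ioo 0 R)) :
    ∫ x in Metric.ball x₀ R, (∫ r in Set.Ioo ‖x - x₀‖ R, g r) * k x
      = ∫ r in Set.Ioo 0 R, g r * ∫ x in Metric.ball x₀ r, k x := by
  have hsw := integral_integral_swap (f := fun x r =>
    {p : Plane × ℝ | ‖p.1 - x₀‖ < p.2}.indicator (fun p : Plane × ℝ => k p.1 * g p.2) (x, r))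
    (integrable_indicator_radial_lt_mul hk hg)
  convert! hsw using 1
  · refine integral_congr_ae (Filter.Eventually.of_forall fun x => ?_)
    simp only
    rw [mul_comm, ← integral_const_mul, ← integral_indicator measurableSet_Ioo,
      ← integral_indicator measurableSet_Ioo]
    refine integral_congr_ae (Filter.Eventually.of_forall fun r => ?_)
    simp only [Set.indicator, Set.mem_Ioo, Set.mem_ofPred_eq]
    have := norm_nonneg (x - x₀)
    split_ifs <;> first | rfl | (exfalso; grind)
  · exact setIntegral_congr_fun measurableSet_Ioo fun r hr =>
      (setIntegral_indicator_radial_lt k g hr.2.le).symm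

/-! ### Mollification and smooth approximation -/

theorem eLpNorm_two_pow {α E : Type*} [MeasurableSpace α] [NormedAddCommGroup E] (f : α → E)
    (μ : Measure α) : eLpNorm f 2 μ ^ 2 = ∫⁻ x, ‖f x‖ₑ ^ 2 ∂μ := by
  have := eLpNorm_nnreal_pow_eq_lintegral (f := f) (p := 2) (μ := μ) two_ne_zero
  simpa using this

open scoped Convolution in
/-- Mollification by a normalised bump function. -/
abbrev mollify (φ : ContDiffBump (0 : Plane)) (f : Plane → ℝ) : Plane → ℝ :=
  φ.normed volume ⋆[ContinuousLinearMap.lsmul ℝ ℝ, volume] f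

theorem mollify_apply (φ : ContDiffBump (0 : Plane)) (f : Plane → ℝ) (x : Plane) :
    mollify φ f x = ∫ t, φ.normed volume t * f (x - t) := rfl

theorem mollify_congr (φ : ContDiffBump (0 : Plane)) {f g : Plane → ℝ} (h : f =ᵐ[volume] g) :
    mollify φ f = mollify φ g :=
  convolution_congr _ Filter.EventuallyEq.rfl h

/-- The kernel is a probability density, so Jensen's inequality bounds the squared mollification by
the mollification of the square; Tonelli and translation invariance finish. -/
theorem eLpNorm_mollify_le_of_measurable (φ : ContDiffBump (0 : Plane)) {f : Plane → ℝ}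
    (hf : Measurable f) : eLpNorm (mollify φ f) 2 volume ≤ eLpNorm f 2 volume := by
  set ρ := φ.normed (volume : Measure Plane) with hρ
  have hρc : Continuous ρ := φ.continuous_normed
  have hρ0 : ∀ t, 0 ≤ ρ t := φ.nonneg_normed
  have hρ1 : ∫⁻ t, ENNReal.ofReal (ρ t) = 1 := by
    rw [← ofReal_integral_eq_lintegral_ofReal φ.integrable_normed
      (Filter.Eventually.of_forall hρ0), φ.integral_normed, ENNReal.ofReal_one]
  have hρm : Measurable fun t => ENNReal.ofReal (ρ t) := hρc.measurable.ennreal_ofReal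
  set ν := (volume : Measure Plane).withDensity fun t => ENNReal.ofReal (ρ t) with hν
  have : IsProbabilityMeasure ν := ⟨by rw [hν, withDensity_apply _ MeasurableSet.univ]; simpa using hρ1⟩
  have key : ∀ x, ‖mollify φ f x‖ₑ ^ 2 ≤ ∫⁻ t, ENNReal.ofReal (ρ t) * ‖f (x - t)‖ₑ ^ 2 := by
    intro x
    have hfm : Measurable fun t => f (x - t) := by fun_prop
    have h1 : ‖mollify φ f x‖ₑ ≤ eLpNorm (fun t => f (x - t)) 1 ν := by
      rw [mollify_apply, eLpNorm_one_eq_lintegral_enorm, hν,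
        lintegral_withDensity_eq_lintegral_mul _ hρm hfm.enorm]
      refine (enorm_integral_le_lintegral_enorm _).trans (le_of_eq ?_)
      refine lintegral_congr fun t => ?_
      rw [enorm_mul, Pi.mul_apply, Real.enorm_of_nonneg (hρ0 t)]
    have h2 := h1.trans (eLpNorm_le_eLpNorm_of_exponent_le (p := 1) (q := 2) (by norm_num)
      hfm.aestronglyMeasurable)
    calc _ ≤ eLpNorm (fun t => f (x - t)) 2 ν ^ 2 := by gcongr
      _ = _ := by
        rw [eLpNorm_two_pow, hν, lintegral_withDensity_eq_lintegral_mul _ hρm (by fun_prop)]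
        rfl
  have h2 : eLpNorm (mollify φ f) 2 volume ^ 2 ≤ eLpNorm f 2 volume ^ 2 := by
    rw [eLpNorm_two_pow, eLpNorm_two_pow]
    refine (lintegral_mono key).trans ?_
    rw [lintegral_lintegral_swap (by fun_prop)]
    calc _ = ∫⁻ t, ENNReal.ofReal (ρ t) * ∫⁻ x, ‖f x‖ₑ ^ 2 := by
          refine lintegral_congr fun t => ?_
          rw [lintegral_const_mul _ (by fun_prop),
            lintegral_sub_right_eq_self (fun x => ‖f x‖ₑ ^ 2) t]
      _ = _ := by rw [lintegral_mul_const _ hρm, hρ1, one_mul]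
      _ ≤ _ := le_rfl
  exact (ENNReal.pow_le_pow_left_iff two_ne_zero).1 h2

theorem eLpNorm_mollify_le (φ : ContDiffBump (0 : Plane)) {f : Plane → ℝ}
    (hf : AEStronglyMeasurable f volume) :
    eLpNorm (mollify φ f) 2 volume ≤ eLpNorm f 2 volume := by
  rw [mollify_congr φ hf.ae_eq_mk, eLpNorm_congr_ae hf.ae_eq_mk]
  exact eLpNorm_mollify_le_of_measurable φ hf.stronglyMeasurable_mk.measurable

theorem contDiff_mollify (φ : ContDiffBump (0 : Plane)) {f : Plane → ℝ}
    (hf : LocallyIntegrable f volume) : ContDiff ℝ ∞ (mollify φ f) :=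
  φ.hasCompactSupport_normed.contDiff_convolution_left _ φ.contDiff_normed hf

theorem mollify_sub (φ : ContDiffBump (0 : Plane)) {f g : Plane → ℝ}
    (hf : LocallyIntegrable f volume) (hg : LocallyIntegrable g volume) :
    mollify φ (f - g) = mollify φ f - mollify φ g := by
  have h : ∀ {k : Plane → ℝ}, LocallyIntegrable k volume → ConvolutionExists (φ.normed volume) k
      (ContinuousLinearMap.lsmul ℝ ℝ) volume := fun hk =>
    φ.hasCompactSupport_normed.convolutionExists_left _ φ.continuous_normed hk
  ext x
  simp only [mollify_apply, Pi.sub_apply, mul_sub]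
  exact integral_sub (h hf x) (h hg x)

/-- Uniform continuity gives uniform convergence. Once the kernel radius is below $1$, all supports
lie in one compact thickening of that of `g`, so convergence holds in $L^2$. -/
theorem tendsto_eLpNorm_mollify_sub_of_continuous {φ : ℕ → ContDiffBump (0 : Plane)}
    (hφ : Filter.Tendsto (fun n => (φ n).rOut) Filter.atTop (nhds 0)) {g : Plane → ℝ}
    (hg : Continuous g) (hgc : HasCompactSupport g) :
    Filter.Tendsto (fun n => eLpNorm (mollify (φ n) g - g) 2 volume) Filter.atTop (nhds 0) := by
  set K := Metric.cthickening 1 (tsupport g) with hK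
  have hKc : IsCompact K := hgc.cthickening
  have hKfin : volume K ^ (1 / (2 : ℝ≥0∞).toReal) ≠ ⊤ :=
    ENNReal.rpow_ne_top_of_nonneg (by positivity) hKc.measure_lt_top.ne
  have hlim : Filter.Tendsto (fun δ : ℝ => ENNReal.ofReal δ * volume K ^ (1 / (2 : ℝ≥0∞).toReal))
      (nhdsWithin 0 (Set.Ioi 0)) (nhds 0) := by
    have h1 : Filter.Tendsto (fun δ : ℝ => ENNReal.ofReal δ) (nhdsWithin 0 (Set.Ioi 0)) (nhds 0) := by
      have := (ENNReal.continuous_ofReal.tendsto 0).mono_left (nhdsWithin_le_nhds (s := Set.Ioi 0))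
      simpa using this
    simpa using ENNReal.Tendsto.mul_const h1 (Or.inr hKfin)
  rw [ENNReal.tendsto_nhds_zero]
  intro ε hε
  obtain ⟨δ, hδε, hδ⟩ := ((hlim.eventually (ge_mem_nhds hε)).and self_mem_nhdsWithin).exists
  obtain ⟨η, hη, hu⟩ := Metric.uniformContinuous_iff.1 (hgc.uniformContinuous_of_continuous hg) δ hδ
  filter_upwards [hφ.eventually (gt_mem_nhds hη), hφ.eventually (gt_mem_nhds one_pos)] with n hn hn1
  refine (eLpNorm_sub_le_of_dist_bdd volume (by norm_num) hKc.isClosed.measurableSet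
    (le_of_lt hδ) (fun x => ?_) ?_ ?_).trans hδε
  · refine (φ n).dist_normed_convolution_le hg.aestronglyMeasurable fun y hy => ?_
    exact (hu (lt_trans hy hn)).le
  · intro x hx
    by_contra hxK
    refine hx ?_
    rw [mollify_apply]
    refine integral_eq_zero_of_ae (Filter.Eventually.of_forall fun t => ?_)
    simp only [Pi.zero_apply, mul_eq_zero]
    by_contra! hcon
    have h1 : t ∈ Metric.ball (0 : Plane) (φ n).rOut := by
      rw [← (φ n).support_normed_eq (μ := volume)]; exact hcon.1
    refine hxK (Metric.mem_cthickening_of_dist_le x (x - t) 1 _ (subset_tsupport g hcon.2) ?_)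
    rw [mem_ball_zero_iff] at h1
    simp only [dist_eq_norm, sub_sub_cancel]
    linarith
  · exact (subset_tsupport g).trans (Metric.self_subset_cthickening _)

theorem tendsto_eLpNorm_mollify_sub {φ : ℕ → ContDiffBump (0 : Plane)}
    (hφ : Filter.Tendsto (fun n => (φ n).rOut) Filter.atTop (nhds 0)) {f : Plane → ℝ}
    (hf : MemLp f 2 volume) :
    Filter.Tendsto (fun n => eLpNorm (mollify (φ n) f - f) 2 volume) Filter.atTop (nhds 0) := by
  rw [ENNReal.tendsto_nhds_zero]
  intro ε hε
  have hε3 : ε / 3 ≠ 0 := (ENNReal.div_pos hε.ne' (by norm_num)).ne'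
  obtain ⟨g, hgc, hfg, hg, hgm⟩ := hf.exists_hasCompactSupport_eLpNorm_sub_le (by norm_num) hε3
  have hlf : LocallyIntegrable f volume := hf.locallyIntegrable (by norm_num)
  have hlg : LocallyIntegrable g volume := hg.locallyIntegrable
  filter_upwards [(ENNReal.tendsto_nhds_zero.1 (tendsto_eLpNorm_mollify_sub_of_continuous hφ hg hgc))
    (ε / 3) (pos_iff_ne_zero.2 hε3)] with n hn
  have e : mollify (φ n) f - f = mollify (φ n) (f - g) + ((mollify (φ n) g - g) - (f - g)) := by
    rw [mollify_sub _ hlf hlg]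
    abel
  have hm1 : AEStronglyMeasurable (mollify (φ n) (f - g)) volume :=
    (contDiff_mollify _ (hlf.sub hlg)).continuous.aestronglyMeasurable
  have hm2 : AEStronglyMeasurable (mollify (φ n) g - g) volume :=
    ((contDiff_mollify _ hlg).continuous.sub hg).aestronglyMeasurable
  have hm3 : AEStronglyMeasurable (f - g) volume := (hf.sub hgm).aestronglyMeasurable
  rw [e]
  calc _ ≤ eLpNorm (mollify (φ n) (f - g)) 2 volume
        + (eLpNorm (mollify (φ n) g - g) 2 volume + eLpNorm (f - g) 2 volume) :=
        (eLpNorm_add_le hm1 (hm2.sub hm3) (by norm_num)).trans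
          (add_le_add le_rfl (eLpNorm_sub_le hm2 hm3 (by norm_num)))
    _ ≤ ε / 3 + (ε / 3 + ε / 3) :=
        add_le_add ((eLpNorm_mollify_le _ hm3).trans hfg) (add_le_add hn hfg)
    _ = ε := by rw [← add_assoc, ENNReal.add_thirds]

theorem isTestFunction_bump_sub {Ω : Set Plane} (φ : ContDiffBump (0 : Plane)) {x : Plane}
    (hx : Metric.closedBall x φ.rOut ⊆ Ω) :
    IsTestFunction Ω fun y => φ.normed volume (x - y) := by
  have hts : tsupport (fun y => φ.normed volume (x - y)) ⊆ Metric.closedBall x φ.rOut := by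
    refine closure_minimal (fun y hy => ?_) Metric.isClosed_closedBall
    have h1 : x - y ∈ Metric.ball (0 : Plane) φ.rOut := by
      rw [← φ.support_normed_eq (μ := volume)]; exact hy
    rw [mem_ball_zero_iff] at h1
    rw [Metric.mem_closedBall, dist_comm, dist_eq_norm]
    exact h1.le
  exact ⟨(φ.contDiff_normed (μ := volume)).comp (contDiff_const.sub contDiff_id),
    HasCompactSupport.of_support_subset_isCompact (isCompact_closedBall x φ.rOut)
      ((subset_tsupport _).trans hts), hts.trans hx⟩

/-- The derivative falls on the kernel, and $y\mapsto\rho(x-y)$ is an admissible test function for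
the weak gradient. Its own minus sign cancels the one in the definition of the weak gradient. The
indicator only serves to make `u` globally integrable. -/
theorem classicalPartial_mollify {Ω : Set Plane} {u : Plane → ℝ} {Du : Fin 2 → Plane → ℝ}
    (hDu : IsWeakGradient Ω u Du) (φ : ContDiffBump (0 : Plane)) {B : Set Plane}
    (hBΩ : B ⊆ Ω)
    (hu : LocallyIntegrable (B.indicator u) volume) {x : Plane}
    (hx : Metric.closedBall x φ.rOut ⊆ B) (i : Fin 2) :
    classicalPartial i (mollify φ (B.indicator u)) x = mollify φ (B.indicator (Du i)) x := by
  have htest := isTestFunction_bump_sub φ (hx.trans hBΩ)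
  have htB := (isTestFunction_bump_sub φ hx).support_subset
  set ψ : Plane → ℝ := fun y => φ.normed volume (x - y) with hψ
  have hd := (φ.hasCompactSupport_normed (μ := volume)).hasFDerivAt_convolution_left
    (ContinuousLinearMap.lsmul ℝ ℝ) ((φ.contDiff_normed (μ := volume) (n := 1))) hu x
  have hpart : ∀ y, classicalPartial i ψ y
      = -(fderiv ℝ (φ.normed volume) (x - y) (EuclideanSpace.single i 1)) := by
    intro y
    have h1 : HasFDerivAt (φ.normed volume) (fderiv ℝ (φ.normed volume) (x - y)) (x - y) :=
      ((φ.contDiff_normed (n := 1)).differentiable (by norm_num) _).hasFDerivAt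
    have h2 := h1.comp y ((hasFDerivAt_id y).const_sub x)
    rw [classicalPartial]
    have : fderiv ℝ ψ y = _ := h2.fderiv
    rw [this]
    simp
  have hexists : Integrable (fun t => ((ContinuousLinearMap.lsmul ℝ ℝ).precompL Plane)
      (fderiv ℝ (φ.normed volume) t) (B.indicator u (x - t))) volume :=
    (φ.hasCompactSupport_normed.fderiv (𝕜 := ℝ)).convolutionExists_left _
      ((φ.contDiff_normed (n := 1)).continuous_fderiv (by norm_num)) hu x
  have h1 : classicalPartial i (mollify φ (B.indicator u)) x
      = ∫ t, fderiv ℝ (φ.normed volume) t (EuclideanSpace.single i 1) * B.indicator u (x - t) := by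
    rw [classicalPartial, hd.fderiv, convolution_def, ContinuousLinearMap.integral_apply hexists]
    rfl
  have hset : ∀ {k h : Plane → ℝ}, (Function.support h ⊆ B) →
      ∫ y, h y * B.indicator k y = ∫ y in Ω, k y * h y := by
    intro k h hh
    rw [← setIntegral_eq_integral_of_forall_compl_eq_zero (s := Ω)]
    · refine integral_congr_ae (Filter.Eventually.of_forall fun y => ?_)
      by_cases hy : y ∈ B
      · simp [Set.indicator_of_mem hy, mul_comm]
      · have : h y = 0 := by
          by_contra hne
          exact hy (hh hne)
        simp [this]
    · intro y hy
      rw [Set.indicator_of_notMem (fun h => hy (hBΩ h)), mul_zero]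
  have h2 : ∫ t, fderiv ℝ (φ.normed volume) t (EuclideanSpace.single i 1) * B.indicator u (x - t)
      = -∫ y in Ω, u y * classicalPartial i ψ y := by
    rw [← integral_sub_left_eq_self _ volume x, ← hset, ← integral_neg]
    · refine integral_congr_ae (Filter.Eventually.of_forall fun y => ?_)
      simp only [hpart, sub_sub_cancel]
      ring
    · intro y hy
      refine htB (support_fderiv_subset ℝ (f := ψ) ?_)
      intro h0
      refine hy ?_
      simp [classicalPartial, h0]
  rw [h1, h2, hDu.integral_eq i ψ htest, neg_neg, mollify_apply,
    ← integral_sub_left_eq_self _ volume x, ← hset ((subset_tsupport ψ).trans htB)]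
  simp only [sub_sub_cancel, hψ]

/-- Local approximation by smooth functions in `H¹`. -/
theorem exists_smooth_approx {Ω : Set Plane} {u : Plane → ℝ} {Du : Fin 2 → Plane → ℝ}
    (hu : MemL2Loc Ω u) (hDu : IsWeakGradient Ω u Du) {x₀ : Plane} {R R₁ : ℝ} (hR : R < R₁)
    (hΩ : Metric.closedBall x₀ R₁ ⊆ Ω) :
    ∃ w : ℕ → Plane → ℝ, (∀ n, ContDiff ℝ ∞ (w n)) ∧
      Filter.Tendsto (fun n => eLpNorm (fun x => w n x - u x) 2
        (volume.restrict (Metric.ball x₀ R))) Filter.atTop (nhds 0) ∧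
      ∀ i, Filter.Tendsto (fun n => eLpNorm (fun x => classicalPartial i (w n) x - Du i x) 2
        (volume.restrict (Metric.ball x₀ R))) Filter.atTop (nhds 0) := by
  set B := Metric.closedBall x₀ R₁ with hB
  have hBm : MeasurableSet B := Metric.isClosed_closedBall.measurableSet
  have hBc : IsCompact B := isCompact_closedBall _ _
  have hU : MemLp (B.indicator u) 2 volume := (memLp_indicator_iff_restrict hBm).2 (hu B hBc hΩ)
  have hV : ∀ i, MemLp (B.indicator (Du i)) 2 volume := fun i =>
    (memLp_indicator_iff_restrict hBm).2 (hDu.memL2Loc i B hBc hΩ)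
  set δ := R₁ - R with hδ
  have hδ0 : 0 < δ := by linarith
  -- The outer radius never exceeds `R₁ - R`, so around each point of the smaller disc the kernel
  -- sees only the larger one; the inner radius is any smaller positive number.
  let φ : ℕ → ContDiffBump (0 : Plane) := fun n =>
    ⟨δ / (n + 2), δ / (n + 1), by positivity, by gcongr; norm_num⟩
  have hφ : Filter.Tendsto (fun n => (φ n).rOut) Filter.atTop (nhds 0) := by
    have := tendsto_one_div_add_atTop_nhds_zero_nat (𝕜 := ℝ)
    simpa [φ, div_eq_mul_inv] using this.const_mul δ
  have hrle : ∀ n, (φ n).rOut ≤ δ := fun n => by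
    change δ / ((n : ℝ) + 1) ≤ δ
    exact div_le_self hδ0.le (by linarith [(Nat.cast_nonneg n : (0 : ℝ) ≤ n)])
  have hsub : Metric.ball x₀ R ⊆ B :=
    Metric.ball_subset_closedBall.trans (Metric.closedBall_subset_closedBall hR.le)
  have hloc := hU.locallyIntegrable (by norm_num)
  refine ⟨fun n => mollify (φ n) (B.indicator u), fun n => contDiff_mollify _ hloc, ?_, fun i => ?_⟩
  · refine tendsto_of_tendsto_of_tendsto_of_le_of_le tendsto_const_nhds
      (tendsto_eLpNorm_mollify_sub hφ hU) (fun _ => zero_le) fun n => ?_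
    refine le_trans (le_of_eq ?_) (eLpNorm_mono_measure _
      (Measure.restrict_le_self (s := Metric.ball x₀ R)))
    refine eLpNorm_congr_ae ?_
    filter_upwards [ae_restrict_mem measurableSet_ball] with x hx
    simp only [Pi.sub_apply, Set.indicator_of_mem (hsub hx)]
  · refine tendsto_of_tendsto_of_tendsto_of_le_of_le tendsto_const_nhds
      (tendsto_eLpNorm_mollify_sub hφ (hV i)) (fun _ => zero_le) fun n => ?_
    refine le_trans (le_of_eq ?_) (eLpNorm_mono_measure _
      (Measure.restrict_le_self (s := Metric.ball x₀ R)))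
    refine eLpNorm_congr_ae ?_
    filter_upwards [ae_restrict_mem measurableSet_ball] with x hx
    have hxB : Metric.closedBall x (φ n).rOut ⊆ B := by
      refine Metric.closedBall_subset_closedBall' ?_
      have := hrle n
      have hx' := Metric.mem_ball.1 hx
      linarith
    rw [classicalPartial_mollify hDu (φ n) hΩ hloc hxB i]
    simp only [Pi.sub_apply, Set.indicator_of_mem (hsub hx)]

/-! ### Radial calculus and the flux identity on circles -/

/-- The outward unit radial field centred at `x₀` (zero at `x₀`). -/
def radialUnit (x₀ x : Plane) : Plane := ‖x - x₀‖⁻¹ • (x - x₀)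

theorem radialUnit_polar (x₀ : Plane) {r : ℝ} (hr : 0 < r) (θ : ℝ) :
    radialUnit x₀ (x₀ + r • circlePoint θ) = circlePoint θ := by
  rw [radialUnit, add_sub_cancel_left, norm_smul, norm_circlePoint, mul_one, Real.norm_eq_abs,
    abs_of_pos hr, smul_smul, inv_mul_cancel₀ hr.ne', one_smul]

theorem norm_polar_sub (x₀ : Plane) {r : ℝ} (hr : 0 < r) (θ : ℝ) :
    ‖x₀ + r • circlePoint θ - x₀‖ = r := by
  rw [add_sub_cancel_left, norm_smul, norm_circlePoint, mul_one, Real.norm_eq_abs, abs_of_pos hr]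

theorem norm_radialUnit_le (x₀ x : Plane) : ‖radialUnit x₀ x‖ ≤ 1 := by
  rw [radialUnit, norm_smul, norm_inv, norm_norm]
  exact inv_mul_le_one

theorem norm_radialUnit {x₀ x : Plane} (h : x ≠ x₀) : ‖radialUnit x₀ x‖ = 1 := by
  rw [radialUnit, norm_smul, norm_inv, norm_norm]
  exact inv_mul_cancel₀ (norm_ne_zero_iff.2 (sub_ne_zero.2 h))

theorem measurable_radialUnit (x₀ : Plane) : Measurable (radialUnit x₀) := by
  unfold radialUnit
  fun_prop

theorem abs_coord_le_norm (v : Plane) (j : Fin 2) : |v j| ≤ ‖v‖ := by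
  simpa using PiLp.norm_apply_le v j

theorem measurable_radialUnit_apply (x₀ : Plane) (j : Fin 2) :
    Measurable fun x => radialUnit x₀ x j := by
  have := measurable_radialUnit x₀
  fun_prop

theorem hasFDerivAt_norm_sub {x₀ x : Plane} (h : x ≠ x₀) :
    HasFDerivAt (fun y : Plane => ‖y - x₀‖) (innerSL ℝ (radialUnit x₀ x)) x := by
  have h0 : x - x₀ ≠ 0 := sub_ne_zero.2 h
  have h1 := ((hasFDerivAt_id x).sub_const x₀).norm_sq
  have h2 := h1.sqrt (by simpa using h0)
  simp only [id, Real.sqrt_sq (norm_nonneg _)] at h2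
  convert! h2 using 1
  ext v
  simp only [radialUnit, innerSL_apply_apply, inner_smul_left, RCLike.conj_to_real,
    _root_.smul_apply, ContinuousLinearMap.comp_apply, smul_eq_mul,
    ContinuousLinearMap.id_apply]
  field_simp
  simp [mul_comm]

/-- A smooth function of the distance to `x₀`, constant for small distances, is smooth. -/
theorem contDiff_comp_norm_sub {η : ℝ → ℝ} (hη : ContDiff ℝ ∞ η) {a : ℝ} (ha : 0 < a)
    (hconst : ∀ ρ, |ρ| < a → η ρ = η 0) (x₀ : Plane) :
    ContDiff ℝ ∞ fun x : Plane => η ‖x - x₀‖ := by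
  rw [contDiff_iff_contDiffAt]
  intro x
  by_cases hx : x = x₀
  · refine (contDiffAt_const (c := η 0)).congr_of_eventuallyEq ?_
    filter_upwards [Metric.ball_mem_nhds x ha] with y hy
    refine hconst _ ?_
    rw [abs_norm, ← dist_eq_norm, ← hx]
    exact hy
  · exact hη.contDiffAt.comp x
      ((contDiff_id.sub contDiff_const).contDiffAt.norm ℝ (sub_ne_zero.2 hx))

theorem memLp_two_ball_integrable {x₀ : Plane} {R : ℝ} {f : Plane → ℝ}
    (hf : MemLp f 2 (volume.restrict (Metric.ball x₀ R))) :
    IntegrableOn f (Metric.ball x₀ R) := by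
  have : IsFiniteMeasure (volume.restrict (Metric.ball x₀ R)) :=
    ⟨by simpa using measure_ball_lt_top (μ := volume) (x := x₀) (r := R)⟩
  exact hf.integrable (by norm_num)

theorem integrableOn_ball_mul_continuous {x₀ : Plane} {R : ℝ} {f g : Plane → ℝ}
    (hf : IntegrableOn f (Metric.ball x₀ R)) (hg : Continuous g) :
    IntegrableOn (fun x => f x * g x) (Metric.ball x₀ R) := by
  obtain ⟨C, hC⟩ := (isCompact_closedBall x₀ R).exists_bound_of_continuousOn hg.continuousOn
  refine Integrable.mul_bdd (c := C) hf hg.aestronglyMeasurable ?_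
  filter_upwards [ae_restrict_mem measurableSet_ball] with x hx
  exact hC x (Metric.ball_subset_closedBall hx)

theorem continuous_classicalPartial {w : Plane → ℝ} (hw : ContDiff ℝ ∞ w) (j : Fin 2) :
    Continuous (classicalPartial j w) :=
  (hw.continuous_fderiv (by simp)).clm_apply continuous_const

theorem integrableOn_radial_flux {x₀ : Plane} {R : ℝ} {F : Fin 2 → Plane → ℝ}
    (hF : ∀ j, IntegrableOn (F j) (Metric.ball x₀ R)) :
    IntegrableOn (fun x => ∑ j, F j x * radialUnit x₀ x j) (Metric.ball x₀ R) := by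
  refine integrable_finsetSum _ fun j _ => ?_
  refine Integrable.mul_bdd (c := 1) (hF j) (measurable_radialUnit_apply x₀ j).aestronglyMeasurable ?_
  exact Filter.Eventually.of_forall fun x =>
    (abs_coord_le_norm _ j).trans (norm_radialUnit_le x₀ x)

theorem classicalPartial_mul {f g : Plane → ℝ} {x : Plane} (hf : DifferentiableAt ℝ f x)
    (hg : DifferentiableAt ℝ g x) (j : Fin 2) :
    classicalPartial j (fun y => f y * g y) x
      = f x * classicalPartial j g x + g x * classicalPartial j f x := by
  simp only [classicalPartial]
  rw [fderiv_fun_mul hf hg]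
  simp

theorem classicalPartial_comp_norm_sub {η : ℝ → ℝ} (hη : Differentiable ℝ η) {x₀ x : Plane}
    (hx : x ≠ x₀) (j : Fin 2) :
    classicalPartial j (fun y => η ‖y - x₀‖) x = deriv η ‖x - x₀‖ * radialUnit x₀ x j := by
  have h := (hη ‖x - x₀‖).hasDerivAt.comp_hasFDerivAt x (hasFDerivAt_norm_sub hx)
  have h' : fderiv ℝ (fun y : Plane => η ‖y - x₀‖) x = _ := h.fderiv
  rw [classicalPartial, h']
  simp [EuclideanSpace.inner_single_right]

/-- Flux identity on almost every circle for a weakly divergence-free field. -/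
theorem ae_flux_eq {x₀ : Plane} {R : ℝ} {F : Fin 2 → Plane → ℝ}
    (hF : ∀ j, IntegrableOn (F j) (Metric.ball x₀ R))
    (hdiv : ∀ φ, IsTestFunction (Metric.ball x₀ R) φ →
      ∫ x in Metric.ball x₀ R, ∑ j, F j x * classicalPartial j φ x = 0)
    {w : Plane → ℝ} (hw : ContDiff ℝ ∞ w) :
    ∀ᵐ r ∂volume.restrict (Set.Ioo 0 R),
      r * ∫ θ in Set.Ioc 0 (2 * Real.pi), (∑ j, F j (x₀ + r • circlePoint θ) * circlePoint θ j)
        * w (x₀ + r • circlePoint θ)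
      = ∫ x in Metric.ball x₀ r, ∑ j, F j x * classicalPartial j w x := by
  set k : Plane → ℝ := fun x => ∑ j, F j x * classicalPartial j w x with hk
  set h : Plane → ℝ := fun x => (∑ j, F j x * radialUnit x₀ x j) * w x with hh
  have hkI : IntegrableOn k (Metric.ball x₀ R) := integrable_finsetSum _ fun j _ =>
    integrableOn_ball_mul_continuous (hF j) (continuous_classicalPartial hw j)
  have hhI : IntegrableOn h (Metric.ball x₀ R) :=
    integrableOn_ball_mul_continuous (integrableOn_radial_flux hF) hw.continuous
  set G : ℝ → ℝ := fun r => r * ∫ θ in Set.Ioc 0 (2 * Real.pi), h (x₀ + r • circlePoint θ) with hG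
  set K : ℝ → ℝ := fun r => ∫ x in Metric.ball x₀ r, k x with hK
  have hGI : IntegrableOn G (Set.Ioo 0 R) := integrableOn_polar hhI
  have hKI : IntegrableOn K (Set.Ioo 0 R) := by
    simpa using integrableOn_mul_setIntegral_ball (g := fun _ => 1) hkI (by simp)
  -- By the fundamental lemma of the calculus of variations it suffices to test against smooth `g`
  -- with compact support in $(0,R)$.
  have key : ∀ᵐ r : ℝ, r ∈ Set.Ioo 0 R → G r - K r = 0 := by
    refine isOpen_Ioo.ae_eq_zero_of_integral_contDiff_smul_eq_zero
      (hGI.sub hKI).locallyIntegrableOn fun g hg hgc hgs => ?_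
    have hg0 : ∀ r, r ∉ Set.Ioo 0 R → g r = 0 := fun r hr =>
      image_eq_zero_of_notMem_tsupport fun h => hr (hgs h)
    obtain ⟨a, ha, hga⟩ : ∃ a > 0, ∀ ρ, |ρ| < a → g ρ = 0 := by
      have : (0 : ℝ) ∉ tsupport g := fun h => (hgs h).1.false
      obtain ⟨a, ha, hs⟩ := Metric.isOpen_iff.1 (isClosed_tsupport g).isOpen_compl 0 this
      refine ⟨a, ha, fun ρ hρ => image_eq_zero_of_notMem_tsupport (hs ?_)⟩
      simpa using hρ
    obtain ⟨b, hb, hgb⟩ : ∃ b < R, ∀ ρ, b < ρ → g ρ = 0 := by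
      have : R ∉ tsupport g := fun h => (hgs h).2.false
      obtain ⟨b, hb, hs⟩ := Metric.isOpen_iff.1 (isClosed_tsupport g).isOpen_compl R this
      refine ⟨R - b, by linarith, fun ρ hρ => ?_⟩
      by_cases hρR : ρ < R
      · refine image_eq_zero_of_notMem_tsupport (hs ?_)
        rw [Metric.mem_ball, Real.dist_eq, abs_lt]
        constructor <;> linarith
      · exact hg0 ρ fun h => hρR h.2
    have hgcont : Continuous g := hg.continuous
    -- The equation is tested with $\eta(|x-x_0|)\,w$, whose gradient is $\eta\nabla w-g\,w\,\nu$.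
    -- The layer-cake formula turns the first term into $\int gK$ and polar coordinates turn the
    -- second into $\int gG$. Since `g` vanishes near $0$ and near $R$, `η` is constant near $0$,
    -- which gives smoothness at `x₀`, and zero near $R$.
    set η : ℝ → ℝ := fun ρ => ∫ t in ρ..R, g t with hη
    have hηd : ∀ ρ, HasDerivAt η (-g ρ) ρ := fun ρ =>
      intervalIntegral.integral_hasDerivAt_left (hgcont.intervalIntegrable _ _)
        (hgcont.stronglyMeasurableAtFilter _ _) hgcont.continuousAt
    have hηderiv : deriv η = fun ρ => -g ρ := funext fun ρ => (hηd ρ).deriv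
    have hηdiff : Differentiable ℝ η := fun ρ => (hηd ρ).differentiableAt
    have hηs : ContDiff ℝ ∞ η :=
      contDiff_infty_iff_deriv.2 ⟨hηdiff, by rw [hηderiv]; exact hg.neg⟩
    have hηconst : ∀ ρ, |ρ| < a → η ρ = η 0 := by
      intro ρ hρ
      have h1 : ∫ t in ρ..0, g t = 0 := by
        refine (intervalIntegral.integral_congr (g := fun _ => (0 : ℝ)) fun t ht => ?_).trans (by simp)
        refine hga t (lt_of_le_of_lt ?_ hρ)
        have := Set.abs_sub_right_of_mem_uIcc ht
        simpa [abs_neg] using this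
      have h2 := intervalIntegral.integral_add_adjacent_intervals
        (hgcont.intervalIntegrable (μ := volume) ρ 0) (hgcont.intervalIntegrable 0 R)
      simp only [hη]
      linarith
    -- Here `ρ` may exceed `R`; the integral then runs backwards but still stays above `b`.
    have hη0 : ∀ ρ, b < ρ → η ρ = 0 := by
      intro ρ hρ
      refine (intervalIntegral.integral_congr (g := fun _ => (0 : ℝ)) fun t ht => ?_).trans (by simp)
      refine hgb t ?_
      exact lt_of_lt_of_le (lt_min hρ hb) ht.1
    set ζ : Plane → ℝ := fun x => η ‖x - x₀‖ with hζ
    have hζs : ContDiff ℝ ∞ ζ := contDiff_comp_norm_sub hηs ha hηconst x₀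
    have hts : tsupport (fun x => ζ x * w x) ⊆ Metric.closedBall x₀ b := by
      refine closure_minimal (fun x hx => ?_) Metric.isClosed_closedBall
      by_contra hxb
      refine hx ?_
      have : ζ x = 0 := hη0 _ (by simpa [dist_eq_norm] using hxb)
      simp [this]
    have htest : IsTestFunction (Metric.ball x₀ R) fun x => ζ x * w x :=
      ⟨hζs.mul hw, HasCompactSupport.of_support_subset_isCompact (isCompact_closedBall x₀ b)
        ((subset_tsupport _).trans hts), hts.trans (Metric.closedBall_subset_ball hb)⟩
    have hzero := hdiv _ htest
    have hζkI : IntegrableOn (fun x => ζ x * k x) (Metric.ball x₀ R) := by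
      simpa only [mul_comm] using integrableOn_ball_mul_continuous hkI hζs.continuous
    have hghI : IntegrableOn (fun x => g ‖x - x₀‖ * h x) (Metric.ball x₀ R) := by
      simpa only [mul_comm] using integrableOn_ball_mul_continuous (g := fun x => g ‖x - x₀‖) hhI
        (by fun_prop)
    have hexp : ∫ x in Metric.ball x₀ R, ∑ j, F j x * classicalPartial j (fun x => ζ x * w x) x
        = ∫ x in Metric.ball x₀ R, (ζ x * k x - g ‖x - x₀‖ * h x) := by
      refine integral_congr_ae ?_
      have hne : ∀ᵐ x ∂volume.restrict (Metric.ball x₀ R), x ≠ x₀ :=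
        ae_restrict_of_ae (Measure.ae_ne volume x₀)
      filter_upwards [hne] with x hx
      have h1 : ∀ j, classicalPartial j (fun x => ζ x * w x) x
          = ζ x * classicalPartial j w x - w x * (g ‖x - x₀‖ * radialUnit x₀ x j) := by
        intro j
        rw [classicalPartial_mul (hζs.differentiable (by simp) x) (hw.differentiable (by simp) x),
          hζ, classicalPartial_comp_norm_sub hηdiff hx, hηderiv]
        ring
      simp only [h1, hk, hh, Fin.sum_univ_two]
      ring
    rw [hexp, integral_sub hζkI hghI] at hzero
    have hA : ∫ x in Metric.ball x₀ R, ζ x * k x = ∫ r in Set.Ioo 0 R, g r * K r := by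
      rw [← setIntegral_radial_primitive_mul hkI (hgcont.integrableOn_Icc.mono_set
        Set.Ioo_subset_Icc_self)]
      refine setIntegral_congr_fun measurableSet_ball fun x hx => ?_
      have hxR : ‖x - x₀‖ ≤ R := by
        rw [← dist_eq_norm]
        exact (Metric.mem_ball.1 hx).le
      simp only [hζ, hη]
      rw [intervalIntegral.integral_of_le hxR, integral_Ioc_eq_integral_Ioo]
    have hB : ∫ x in Metric.ball x₀ R, g ‖x - x₀‖ * h x = ∫ r in Set.Ioo 0 R, g r * G r := by
      rw [setIntegral_ball_eq_polar hghI]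
      refine setIntegral_congr_fun measurableSet_Ioo fun r hr => ?_
      simp only [norm_polar_sub x₀ hr.1, hG]
      rw [integral_const_mul]
      ring
    have hgG : IntegrableOn (fun r => g r * G r) (Set.Ioo 0 R) := by
      obtain ⟨C, hC⟩ := hgc.exists_bound_of_continuous hgcont
      exact Integrable.bdd_mul (c := C) hGI hgcont.aestronglyMeasurable
        (Filter.Eventually.of_forall hC)
    have hgK : IntegrableOn (fun r => g r * K r) (Set.Ioo 0 R) :=
      integrableOn_mul_setIntegral_ball hkI (hgcont.integrableOn_Icc.mono_set
        Set.Ioo_subset_Icc_self)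
    rw [← setIntegral_eq_integral_of_forall_compl_eq_zero (s := Set.Ioo 0 R)
      (fun r hr => by rw [hg0 r hr, zero_smul])]
    simp only [smul_eq_mul, mul_sub]
    rw [integral_sub hgG hgK]
    linarith
  rw [← ae_restrict_iff' measurableSet_Ioo] at key
  filter_upwards [key, ae_restrict_mem measurableSet_Ioo] with r hr hr0
  have : G r = K r := by linarith
  rw [← show K r = ∫ x in Metric.ball x₀ r, k x from rfl, ← this]
  simp only [hG, hh, radialUnit_polar x₀ hr0.1]

/-! ### Flux through a circle bounded by weighted energies -/

theorem intervalIntegrable_of_bounds {a : ℝ → ℝ} {lam Lam T : ℝ} (hT : 0 ≤ T)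
    (hlam : 0 < lam) (hb : ∀ t, lam ≤ a t ∧ a t ≤ Lam)
    (ham : AEStronglyMeasurable a (volume.restrict (Set.Ioc 0 T))) :
    IntervalIntegrable a volume 0 T := by
  rw [intervalIntegrable_iff_integrableOn_Ioc_of_le hT]
  refine (integrable_const Lam).mono' ham (Filter.Eventually.of_forall fun t => ?_)
  rw [Real.norm_eq_abs, abs_of_pos (hlam.trans_le (hb t).1)]
  exact (hb t).2

/-- The product of a mean-zero function with a periodic function, bounded by weighted energies. -/
theorem setIntegral_mul_le_weighted_energy {a y f : ℝ → ℝ} {lam Lam r : ℝ} (hr : 0 < r)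
    (hlam : 0 < lam) (hb : ∀ t, lam ≤ a t ∧ a t ≤ Lam)
    (ham : AEStronglyMeasurable a (volume.restrict (Set.Ioc 0 (2 * Real.pi))))
    (hap : Function.Periodic a (2 * Real.pi)) (hy : ContDiff ℝ 1 y)
    (hyp : Function.Periodic y (2 * Real.pi))
    (hf : IntegrableOn f (Set.Ioc 0 (2 * Real.pi)))
    (hf2 : IntegrableOn (fun t => f t ^ 2 * (a t)⁻¹) (Set.Ioc 0 (2 * Real.pi)))
    (hf0 : ∫ t in Set.Ioc 0 (2 * Real.pi), f t = 0) :
    ∫ t in Set.Ioc 0 (2 * Real.pi), f t * y t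
      ≤ (∫ t in Set.Ioc 0 (2 * Real.pi), a t) / (4 * Real.pi)
        * (r⁻¹ * (∫ t in Set.Ioc 0 (2 * Real.pi), deriv y t ^ 2 * (a t)⁻¹)
          + r * ∫ t in Set.Ioc 0 (2 * Real.pi), f t ^ 2 * (a t)⁻¹) := by
  have h2π := Real.two_pi_pos
  have haI := intervalIntegrable_of_bounds h2π.le hlam hb ham
  obtain ⟨c, hc⟩ := weighted_wirtinger_periodic h2π hlam haI hb hap hy hyp
  have hapos : ∀ t, 0 < a t := fun t => hlam.trans_le (hb t).1
  have hL : 0 < ∫ t in 0..(2 * Real.pi), a t :=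
    intervalIntegral.intervalIntegral_pos_of_pos haI hapos h2π
  simp only [intervalIntegral.integral_of_le h2π.le] at hc hL
  set L := ∫ t in Set.Ioc 0 (2 * Real.pi), a t
  set Y := ∫ t in Set.Ioc 0 (2 * Real.pi), deriv y t ^ 2 * (a t)⁻¹
  set Z := ∫ t in Set.Ioc 0 (2 * Real.pi), f t ^ 2 * (a t)⁻¹
  have hyc := hy.continuous
  have hfy : ∀ {k : ℝ → ℝ}, Continuous k →
      IntegrableOn (fun t => f t * k t) (Set.Ioc 0 (2 * Real.pi)) := by
    intro k hk
    obtain ⟨C, hC⟩ := (isCompact_Icc (a := 0) (b := 2 * Real.pi)).exists_bound_of_continuousOn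
      hk.continuousOn
    refine Integrable.mul_bdd (c := C) hf hk.aestronglyMeasurable ?_
    filter_upwards [ae_restrict_mem measurableSet_Ioc] with t ht
    exact hC t (Set.Ioc_subset_Icc_self ht)
  have e1 : ∫ t in Set.Ioc 0 (2 * Real.pi), f t * y t
      = ∫ t in Set.Ioc 0 (2 * Real.pi), f t * (y t - c) := by
    simp only [mul_sub]
    rw [integral_sub (hfy hyc) (hf.mul_const c), integral_mul_const, hf0]
    ring
  have haY : IntegrableOn (fun t => a t * (y t - c) ^ 2) (Set.Ioc 0 (2 * Real.pi)) := by
    have := haI.mul_continuousOn (g := fun t => (y t - c) ^ 2) (by fun_prop)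
    rwa [intervalIntegrable_iff_integrableOn_Ioc_of_le h2π.le] at this
  -- The Young parameter that balances the two terms: after the Wirtinger inequality the
  -- coefficients become $L/(4\pi r)$ and $Lr/(4\pi)$, which scale alike once the angular derivative
  -- is written as $r$ times the tangential one.
  set κ := 2 * Real.pi / (L * r) with hκ
  have hκ0 : 0 < κ := by positivity
  have h1 : ∫ t in Set.Ioc 0 (2 * Real.pi), f t * (y t - c)
      ≤ ∫ t in Set.Ioc 0 (2 * Real.pi),
        (κ / 2 * (a t * (y t - c) ^ 2) + κ⁻¹ / 2 * (f t ^ 2 * (a t)⁻¹)) := by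
    refine integral_mono (hfy (by fun_prop)) ((haY.const_mul _).add (hf2.const_mul _)) fun t => ?_
    have hat := hapos t
    have : 0 ≤ (κ * (a t * (y t - c)) - f t) ^ 2 * (κ⁻¹ * (a t)⁻¹) / 2 := by positivity
    have e : (κ * (a t * (y t - c)) - f t) ^ 2 * (κ⁻¹ * (a t)⁻¹) / 2
        = κ / 2 * (a t * (y t - c) ^ 2) + κ⁻¹ / 2 * (f t ^ 2 * (a t)⁻¹) - f t * (y t - c) := by
      field_simp
      ring
    rw [e] at this
    simp only
    linarith
  rw [integral_add (haY.const_mul _) (hf2.const_mul _), integral_const_mul,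
    integral_const_mul] at h1
  set W := ∫ t in Set.Ioc 0 (2 * Real.pi), a t * (y t - c) ^ 2
  have h2 : W ≤ (L / (2 * Real.pi)) ^ 2 * Y := by
    have : (L / (2 * Real.pi)) ^ 2 * ((2 * Real.pi / L) ^ 2 * W) = W := by
      field_simp
    rw [← this]
    exact mul_le_mul_of_nonneg_left hc (by positivity)
  rw [e1]
  refine h1.trans ?_
  have h3 : κ / 2 * W ≤ κ / 2 * ((L / (2 * Real.pi)) ^ 2 * Y) :=
    mul_le_mul_of_nonneg_left h2 (by positivity)
  have h4 : κ / 2 * ((L / (2 * Real.pi)) ^ 2 * Y) + κ⁻¹ / 2 * Z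
      = L / (4 * Real.pi) * (r⁻¹ * Y + r * Z) := by
    rw [hκ]
    field_simp
    ring
  linarith

/-! ### Coefficients, fluxes and the unimodular identity -/

/-- The component along the circle centred at `x₀` of a vector field. -/
def tangential (x₀ : Plane) (V : Fin 2 → Plane → ℝ) (x : Plane) : ℝ :=
  V 1 x * radialUnit x₀ x 0 - V 0 x * radialUnit x₀ x 1

/-- The `j`-th component of the flux `A V`. -/
def flux (A : CoeffField) (V : Fin 2 → Plane → ℝ) (j : Fin 2) (x : Plane) : ℝ :=
  ∑ i, A x i j * V i x

/-- The coefficient `a_ij ν_i ν_j` in the radial direction. -/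
def radialCoeff (A : CoeffField) (x₀ x : Plane) : ℝ := quadForm A x (radialUnit x₀ x)

/-- The energy density `a_ij V_i V_j`. -/
def energyDensity (A : CoeffField) (V : Fin 2 → Plane → ℝ) (x : Plane) : ℝ :=
  ∑ j, flux A V j x * V j x

/-- Pointwise assumptions on the coefficients. -/
structure IsEllipticOn (A : CoeffField) (lam Lam : ℝ) (B : Set Plane) : Prop where
  pos : 0 < lam
  meas : ∀ i j, AEMeasurable (fun x => A x i j) (volume.restrict B)
  bounds : ∀ x ∈ B, ∀ ξ : Plane,
    lam * ‖ξ‖ ^ 2 ≤ quadForm A x ξ ∧ quadForm A x ξ ≤ Lam * ‖ξ‖ ^ 2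
  symm : ∀ x ∈ B, ∀ i j, A x i j = A x j i
  det : ∀ x ∈ B, (A x).det = 1

theorem IsEllipticOn.mono {A : CoeffField} {lam Lam : ℝ} {B B' : Set Plane}
    (h : IsEllipticOn A lam Lam B) (hB : B' ⊆ B) : IsEllipticOn A lam Lam B' where
  pos := h.pos
  meas i j := (h.meas i j).mono_set hB
  bounds x hx := h.bounds x (hB hx)
  symm x hx := h.symm x (hB hx)
  det x hx := h.det x (hB hx)

theorem quadForm_eq (A : CoeffField) (x ξ : Plane) :
    quadForm A x ξ = A x 0 0 * ξ 0 ^ 2 + (A x 0 1 + A x 1 0) * (ξ 0 * ξ 1) + A x 1 1 * ξ 1 ^ 2 := by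
  simp only [quadForm, Fin.sum_univ_two]
  ring

/-- The diagonal entries are values of the form at unit vectors; the determinant condition then
gives $a_{01}^2=a_{00}a_{11}-1\le\Lambda^2$. -/
theorem IsEllipticOn.abs_le {A : CoeffField} {lam Lam : ℝ} {B : Set Plane}
    (h : IsEllipticOn A lam Lam B) {x : Plane} (hx : x ∈ B) (i j : Fin 2) :
    |A x i j| ≤ Lam := by
  have h0 := h.bounds x hx (EuclideanSpace.single 0 1)
  have h1 := h.bounds x hx (EuclideanSpace.single 1 1)
  have hd := h.det x hx
  have hs := h.symm x hx 0 1
  have hpos := h.pos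
  simp only [quadForm_eq, PiLp.norm_single] at h0 h1
  simp at h0 h1
  rw [Matrix.det_fin_two, ← hs] at hd
  have h00 : |A x 0 0| ≤ Lam := _root_.abs_le.2 ⟨by linarith, h0.2⟩
  have h11 : |A x 1 1| ≤ Lam := _root_.abs_le.2 ⟨by linarith, h1.2⟩
  have h01 : |A x 0 1| ≤ Lam := by
    refine abs_le_of_sq_le_sq ?_ (by linarith)
    nlinarith [h0.1, h0.2, h1.1, h1.2]
  fin_cases i <;> fin_cases j
  · exact h00
  · exact h01
  · exact hs ▸ h01
  · exact h11

/-- The Gram identity for the inner product defined by $A$: $(A\nu\cdot\nu)(AV\cdot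
V)-(AV\cdot\nu)^2=\det A\,\det(\nu,V)^2$. This is where $\det A=1$ makes the estimate sharp; no
normalisation of $\nu$ enters. -/
theorem sq_tangential_add_sq_flux {A : CoeffField} {x : Plane} (x₀ : Plane)
    (V : Fin 2 → Plane → ℝ) (hs : ∀ i j, A x i j = A x j i) (hd : (A x).det = 1) :
    tangential x₀ V x ^ 2 + (∑ j, flux A V j x * radialUnit x₀ x j) ^ 2
      = radialCoeff A x₀ x * energyDensity A V x := by
  have h01 := hs 1 0
  rw [Matrix.det_fin_two, h01] at hd
  simp only [tangential, radialCoeff, energyDensity, flux, quadForm_eq, Fin.sum_univ_two, h01]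
  linear_combination (-(V 1 x * radialUnit x₀ x 0 - V 0 x * radialUnit x₀ x 1) ^ 2) * hd

theorem le_energyDensity {A : CoeffField} {lam Lam : ℝ} {B : Set Plane}
    (h : IsEllipticOn A lam Lam B) {x : Plane} (hx : x ∈ B) (V : Fin 2 → Plane → ℝ) :
    lam * ∑ i, V i x ^ 2 ≤ energyDensity A V x := by
  have h1 := (h.bounds x hx !₂[V 0 x, V 1 x]).1
  rw [EuclideanSpace.real_norm_sq_eq, quadForm_eq] at h1
  simp only [energyDensity, flux, Fin.sum_univ_two] at h1 ⊢
  simp at h1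
  linarith

theorem radialCoeff_bounds {A : CoeffField} {lam Lam : ℝ} {B : Set Plane}
    (h : IsEllipticOn A lam Lam B) {x₀ x : Plane} (hx : x ∈ B) (hne : x ≠ x₀) :
    lam ≤ radialCoeff A x₀ x ∧ radialCoeff A x₀ x ≤ Lam := by
  have := h.bounds x hx (radialUnit x₀ x)
  rwa [norm_radialUnit hne, one_pow, mul_one, mul_one] at this

theorem aemeasurable_quadForm {A : CoeffField} {μ : Measure Plane}
    (h : ∀ i j, AEMeasurable (fun x => A x i j) μ) {ξ : Plane → Plane}
    (hξ : Measurable ξ) : AEMeasurable (fun x => quadForm A x (ξ x)) μ := by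
  simp only [quadForm_eq]
  have h00 := h 0 0
  have h01 := h 0 1
  have h10 := h 1 0
  have h11 := h 1 1
  have hm : ∀ j, AEMeasurable (fun x => ξ x j) μ := fun j => by fun_prop
  have hm0 := hm 0
  have hm1 := hm 1
  fun_prop

theorem MeasureTheory.MemLp.two_bdd_mul {α : Type*} [MeasurableSpace α] {μ : Measure α} {f g : α → ℝ} {C : ℝ}
    (hf : MemLp f 2 μ) (hg : AEStronglyMeasurable g μ) (hC : ∀ᵐ x ∂μ, |g x| ≤ C) :
    MemLp (fun x => g x * f x) 2 μ := by
  refine MemLp.of_le_mul (c := C) hf (hg.mul hf.aestronglyMeasurable) ?_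
  filter_upwards [hC] with x hx
  rw [norm_mul]
  exact mul_le_mul_of_nonneg_right hx (norm_nonneg _)

theorem memLp_flux {A : CoeffField} {lam Lam : ℝ} {B : Set Plane} (hB : MeasurableSet B)
    (h : IsEllipticOn A lam Lam B) {V : Fin 2 → Plane → ℝ}
    (hV : ∀ i, MemLp (V i) 2 (volume.restrict B)) (j : Fin 2) :
    MemLp (flux A V j) 2 (volume.restrict B) := by
  refine memLp_finsetSum _ fun i _ => ?_
  refine MemLp.two_bdd_mul (C := Lam) (hV i) (h.meas i j).aestronglyMeasurable ?_
  filter_upwards [ae_restrict_mem hB] with x hx using h.abs_le hx i j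

theorem ae_abs_radialUnit_le (μ : Measure Plane) (x₀ : Plane) (j : Fin 2) :
    ∀ᵐ x ∂μ, |radialUnit x₀ x j| ≤ 1 :=
  Filter.Eventually.of_forall fun x => (abs_coord_le_norm _ j).trans (norm_radialUnit_le x₀ x)

theorem memLp_tangential {μ : Measure Plane} {V : Fin 2 → Plane → ℝ} (x₀ : Plane)
    (hV : ∀ i, MemLp (V i) 2 μ) : MemLp (tangential x₀ V) 2 μ := by
  have h := fun i j => MemLp.two_bdd_mul (C := 1) (hV i)
    (measurable_radialUnit_apply x₀ j).aestronglyMeasurable (ae_abs_radialUnit_le μ x₀ j)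
  refine ((h 1 0).sub (h 0 1)).congr_norm ?_ ?_
  · have := fun j => (measurable_radialUnit_apply x₀ j).aestronglyMeasurable (μ := μ)
    exact ((hV 1).1.mul (this 0)).sub ((hV 0).1.mul (this 1))
  · refine Filter.Eventually.of_forall fun x => ?_
    simp only [tangential, Pi.sub_apply, mul_comm]

theorem memLp_radial_flux {μ : Measure Plane} {F : Fin 2 → Plane → ℝ} (x₀ : Plane)
    (hF : ∀ i, MemLp (F i) 2 μ) : MemLp (fun x => ∑ j, F j x * radialUnit x₀ x j) 2 μ := by
  refine memLp_finsetSum _ fun j _ => ?_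
  simpa only [mul_comm] using MemLp.two_bdd_mul (C := 1) (hF j)
    (measurable_radialUnit_apply x₀ j).aestronglyMeasurable (ae_abs_radialUnit_le μ x₀ j)

theorem hasDerivAt_comp_polar {w : Plane → ℝ} (hw : Differentiable ℝ w) (x₀ : Plane) {r : ℝ}
    (hr : 0 < r) (θ : ℝ) :
    HasDerivAt (fun θ => w (x₀ + r • circlePoint θ))
      (r * tangential x₀ (fun i => classicalPartial i w) (x₀ + r • circlePoint θ)) θ := by
  have hc : HasDerivAt circlePoint !₂[-Real.sin θ, Real.cos θ] θ := by
    have h1 : HasDerivAt (fun θ : ℝ => ![Real.cos θ, Real.sin θ]) ![-Real.sin θ, Real.cos θ] θ := by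
      rw [hasDerivAt_pi]
      intro i
      fin_cases i
      · simpa using Real.hasDerivAt_cos θ
      · simpa using Real.hasDerivAt_sin θ
    exact (PiLp.continuousLinearEquiv 2 ℝ fun _ : Fin 2 => ℝ).symm.toContinuousLinearMap.hasFDerivAt.comp_hasDerivAt θ h1
  have h := ((hw (x₀ + r • circlePoint θ)).hasFDerivAt).comp_hasDerivAt θ
    ((hc.const_smul r).const_add x₀)
  convert! h using 1
  rw [tangential, radialUnit_polar x₀ hr]
  have e : (!₂[-Real.sin θ, Real.cos θ] : Plane)
      = (-Real.sin θ) • EuclideanSpace.single 0 1 + Real.cos θ • EuclideanSpace.single 1 1 := by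
    ext i
    fin_cases i <;> simp
  rw [e, map_smul, map_add, map_smul, map_smul]
  simp only [classicalPartial, smul_eq_mul, circlePoint_apply_zero, circlePoint_apply_one]
  ring

/-- The comparison density for a smooth function `w` and the flux of `V`. -/
def mixedDensity (A : CoeffField) (x₀ : Plane) (w : Plane → ℝ) (V : Fin 2 → Plane → ℝ)
    (x : Plane) : ℝ :=
  tangential x₀ (fun i => classicalPartial i w) x ^ 2 * (radialCoeff A x₀ x)⁻¹
    + (∑ j, flux A V j x * radialUnit x₀ x j) ^ 2 * (radialCoeff A x₀ x)⁻¹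

theorem aestronglyMeasurable_inv_radialCoeff {A : CoeffField} {lam Lam : ℝ} {B : Set Plane}
    (h : IsEllipticOn A lam Lam B) (x₀ : Plane) :
    AEStronglyMeasurable (fun x => (radialCoeff A x₀ x)⁻¹) (volume.restrict B) :=
  (aemeasurable_quadForm h.meas (measurable_radialUnit x₀)).inv.aestronglyMeasurable

theorem ae_abs_inv_radialCoeff_le {A : CoeffField} {lam Lam : ℝ} {B : Set Plane}
    (hB : MeasurableSet B) (h : IsEllipticOn A lam Lam B) (x₀ : Plane) :
    ∀ᵐ x ∂volume.restrict B, |(radialCoeff A x₀ x)⁻¹| ≤ lam⁻¹ := by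
  have hne : ∀ᵐ x ∂volume.restrict B, x ≠ x₀ := ae_restrict_of_ae (Measure.ae_ne volume x₀)
  filter_upwards [ae_restrict_mem hB, hne] with x hx hx0
  have hb := (radialCoeff_bounds h hx hx0).1
  rw [abs_inv, abs_of_pos (h.pos.trans_le hb)]
  exact inv_anti₀ h.pos hb

theorem integrableOn_sq_mul_inv_radialCoeff {A : CoeffField} {lam Lam : ℝ} {B : Set Plane}
    (hB : MeasurableSet B) (h : IsEllipticOn A lam Lam B) (x₀ : Plane) {f : Plane → ℝ}
    (hf : MemLp f 2 (volume.restrict B)) :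
    IntegrableOn (fun x => f x ^ 2 * (radialCoeff A x₀ x)⁻¹) B :=
  Integrable.mul_bdd (c := lam⁻¹) hf.integrable_sq (aestronglyMeasurable_inv_radialCoeff h x₀)
    (ae_abs_inv_radialCoeff_le hB h x₀)

theorem memLp_continuous_ball {x₀ : Plane} {R : ℝ} {f : Plane → ℝ} (hf : Continuous f) :
    MemLp f 2 (volume.restrict (Metric.ball x₀ R)) := by
  obtain ⟨C, hC⟩ := (isCompact_closedBall x₀ R).exists_bound_of_continuousOn hf.continuousOn
  have : IsFiniteMeasure (volume.restrict (Metric.ball x₀ R)) :=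
    ⟨by simpa using measure_ball_lt_top (μ := volume) (x := x₀) (r := R)⟩
  refine MemLp.of_bound hf.aestronglyMeasurable C ?_
  filter_upwards [ae_restrict_mem measurableSet_ball] with x hx
  exact hC x (Metric.ball_subset_closedBall hx)

/-! ### Energy inequality on discs -/

/-- The weak form of $E\le\frac{S}{4\pi}rE'$. Wirtinger is applied to the smooth `w` on the circle,
while the flux comes from `V`, so no trace of the solution is needed. When `V` is the gradient of
`w`, `mixedDensity` is the energy density away from `x₀`. -/
theorem ae_setIntegral_flux_le {A : CoeffField} {lam Lam S : ℝ} {x₀ : Plane} {R : ℝ}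
    (h : IsEllipticOn A lam Lam (Metric.ball x₀ R)) {V : Fin 2 → Plane → ℝ}
    (hV : ∀ i, MemLp (V i) 2 (volume.restrict (Metric.ball x₀ R)))
    (hdiv : ∀ φ, IsTestFunction (Metric.ball x₀ R) φ →
      ∫ x in Metric.ball x₀ R, ∑ j, flux A V j x * classicalPartial j φ x = 0)
    (hS : ∀ᵐ r ∂volume.restrict (Set.Ioo 0 R), ∫ θ in Set.Ioc 0 (2 * Real.pi),
      quadForm A (x₀ + r • circlePoint θ) (circlePoint θ) ≤ S)
    {w : Plane → ℝ} (hw : ContDiff ℝ ∞ w) :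
    ∀ᵐ r ∂volume.restrict (Set.Ioo 0 R),
      ∫ x in Metric.ball x₀ r, ∑ j, flux A V j x * classicalPartial j w x
      ≤ S / (4 * Real.pi) * (r * (r * ∫ θ in Set.Ioc 0 (2 * Real.pi),
        mixedDensity A x₀ w V (x₀ + r • circlePoint θ))) := by
  have hB : MeasurableSet (Metric.ball x₀ R) := measurableSet_ball
  have hF2 := memLp_flux hB h hV
  have hF : ∀ j, IntegrableOn (flux A V j) (Metric.ball x₀ R) := fun j =>
    memLp_two_ball_integrable (hF2 j)
  have hT2 : MemLp (tangential x₀ fun i => classicalPartial i w) 2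
      (volume.restrict (Metric.ball x₀ R)) :=
    memLp_tangential x₀ fun i => memLp_continuous_ball (continuous_classicalPartial hw i)
  have hFn := memLp_radial_flux x₀ hF2
  -- The flux identity is used twice: with `w` it expresses the disc integral on the circle, and
  -- with the constant $1$ it shows that the flux has mean zero.
  filter_upwards [ae_flux_eq hF hdiv hw, ae_flux_eq hF hdiv (contDiff_const (c := 1)), hS,
    ae_restrict_mem measurableSet_Ioo,
    ae_integrable_polar (memLp_two_ball_integrable hFn),
    ae_integrable_polar (integrableOn_sq_mul_inv_radialCoeff hB h x₀ hFn),
    ae_integrable_polar (integrableOn_sq_mul_inv_radialCoeff hB h x₀ hT2),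
    ae_aestronglyMeasurable_polar (aemeasurable_quadForm h.meas
      (measurable_radialUnit x₀)).aestronglyMeasurable] with r h1 h2 h3 h4 h5 h6 h7 h8
  have hr := h4.1
  set P : ℝ → Plane := fun θ => x₀ + r • circlePoint θ with hP
  have hPp : Function.Periodic P (2 * Real.pi) := fun θ => by
    simp only [hP, circlePoint_periodic θ]
  have hPs : ContDiff ℝ 1 P := contDiff_const.add (contDiff_circlePoint.const_smul r)
  have hPball : ∀ θ, P θ ∈ Metric.ball x₀ R := fun θ => by
    rw [Metric.mem_ball, dist_eq_norm, norm_polar_sub x₀ hr]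
    exact h4.2
  have hPne : ∀ θ, P θ ≠ x₀ := fun θ he => by
    have := norm_polar_sub x₀ hr θ
    rw [show x₀ + r • circlePoint θ = x₀ from he, sub_self, norm_zero] at this
    exact hr.ne this
  set a : ℝ → ℝ := fun θ => radialCoeff A x₀ (P θ) with ha
  set f : ℝ → ℝ := fun θ => ∑ j, flux A V j (P θ) * radialUnit x₀ (P θ) j with hf
  have hPn : ∀ θ, radialUnit x₀ (P θ) = circlePoint θ := fun θ => radialUnit_polar x₀ hr θ
  have hf0 : ∫ t in Set.Ioc 0 (2 * Real.pi), f t = 0 := by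
    have e : ∀ j x, classicalPartial j (fun _ => (1 : ℝ)) x = 0 := by
      intro j x
      simp [classicalPartial]
    simp only [e, mul_zero, Finset.sum_const_zero, integral_zero, mul_one] at h2
    have := (mul_eq_zero.1 h2).resolve_left hr.ne'
    simpa only [hf, hPn] using this
  have hmain := setIntegral_mul_le_weighted_energy (a := a) (y := fun θ => w (P θ)) (f := f) hr
    h.pos (fun t => radialCoeff_bounds h (hPball t) (hPne t)) h8
    (fun t => by simp only [ha, hPp t]) ((hw.of_le (by simp)).comp hPs)
    (fun t => by simp only [hPp t]) h5 h6 hf0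
  have hderiv : deriv (fun θ => w (P θ))
      = fun θ => r * tangential x₀ (fun i => classicalPartial i w) (P θ) :=
    funext fun θ => (hasDerivAt_comp_polar (hw.differentiable (by simp)) x₀ hr θ).deriv
  have hK : r * ∫ t in Set.Ioc 0 (2 * Real.pi), f t * w (P t)
      = ∫ x in Metric.ball x₀ r, ∑ j, flux A V j x * classicalPartial j w x := by
    rw [← h1]
    simp only [hf, hPn]
    rfl
  have hL : ∫ t in Set.Ioc 0 (2 * Real.pi), a t ≤ S := by
    simpa only [ha, radialCoeff, hPn] using h3
  set T : ℝ → ℝ := fun θ => tangential x₀ (fun i => classicalPartial i w) (P θ) with hT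
  have hY : ∫ t in Set.Ioc 0 (2 * Real.pi), deriv (fun θ => w (P θ)) t ^ 2 * (a t)⁻¹
      = r ^ 2 * ∫ t in Set.Ioc 0 (2 * Real.pi), T t ^ 2 * (a t)⁻¹ := by
    rw [← integral_const_mul, hderiv]
    refine integral_congr_ae (Filter.Eventually.of_forall fun t => ?_)
    simp only [hT]
    ring
  have hD : ∫ θ in Set.Ioc 0 (2 * Real.pi), mixedDensity A x₀ w V (P θ)
      = (∫ t in Set.Ioc 0 (2 * Real.pi), T t ^ 2 * (a t)⁻¹)
        + ∫ t in Set.Ioc 0 (2 * Real.pi), f t ^ 2 * (a t)⁻¹ := by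
    rw [← integral_add h7 h6]
    rfl
  rw [← hK, hD]
  rw [hY] at hmain
  have hapos : ∀ t, 0 ≤ (a t)⁻¹ := fun t =>
    inv_nonneg.2 (h.pos.le.trans (radialCoeff_bounds h (hPball t) (hPne t)).1)
  have hY0 : 0 ≤ ∫ t in Set.Ioc 0 (2 * Real.pi), T t ^ 2 * (a t)⁻¹ :=
    integral_nonneg fun t => mul_nonneg (sq_nonneg _) (hapos t)
  have hZ0 : 0 ≤ ∫ t in Set.Ioc 0 (2 * Real.pi), f t ^ 2 * (a t)⁻¹ :=
    integral_nonneg fun t => mul_nonneg (sq_nonneg _) (hapos t)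
  set Y := ∫ t in Set.Ioc 0 (2 * Real.pi), T t ^ 2 * (a t)⁻¹
  set Z := ∫ t in Set.Ioc 0 (2 * Real.pi), f t ^ 2 * (a t)⁻¹
  calc _ ≤ r * ((∫ t in Set.Ioc 0 (2 * Real.pi), a t) / (4 * Real.pi)
        * (r⁻¹ * (r ^ 2 * Y) + r * Z)) := mul_le_mul_of_nonneg_left hmain hr.le
    _ = (∫ t in Set.Ioc 0 (2 * Real.pi), a t) / (4 * Real.pi) * (r * (r * (Y + Z))) := by
        field_simp
    _ ≤ _ := by
        refine mul_le_mul_of_nonneg_right ?_ (by positivity)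
        gcongr

/-! ### Passage to the limit in the smooth approximation -/

open Filter in
theorem tendsto_integral_mul_of_tendsto_eLpNorm {α : Type*} [MeasurableSpace α] {μ : Measure α}
    {f g : ℕ → α → ℝ} {f' g' : α → ℝ} (hf : ∀ n, MemLp (f n) 2 μ) (hf' : MemLp f' 2 μ)
    (hg : ∀ n, MemLp (g n) 2 μ) (hg' : MemLp g' 2 μ)
    (hfl : Tendsto (fun n => eLpNorm (f n - f') 2 μ) atTop (nhds 0))
    (hgl : Tendsto (fun n => eLpNorm (g n - g') 2 μ) atTop (nhds 0)) :
    Tendsto (fun n => ∫ x, f n x * g n x ∂μ) atTop (nhds (∫ x, f' x * g' x ∂μ)) := by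
  have h1 := (Lp.tendsto_Lp_iff_tendsto_eLpNorm'' f hf f' hf').2 hfl
  have h2 := (Lp.tendsto_Lp_iff_tendsto_eLpNorm'' g hg g' hg').2 hgl
  have h3 := h1.inner (𝕜 := ℝ) h2
  have e : ∀ {u v : α → ℝ} (hu : MemLp u 2 μ) (hv : MemLp v 2 μ),
      inner ℝ (hu.toLp u) (hv.toLp v) = ∫ x, u x * v x ∂μ := by
    intro u v hu hv
    rw [L2.inner_def]
    refine integral_congr_ae ?_
    filter_upwards [hu.coeFn_toLp, hv.coeFn_toLp] with x h1 h2
    rw [h1, h2]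
    simp [mul_comm]
  simpa only [e] using h3

open Filter in
theorem tendsto_eLpNorm_bdd_mul {α : Type*} [MeasurableSpace α] {μ : Measure α}
    {f : ℕ → α → ℝ} {f' b : α → ℝ} {C : ℝ} (hb : ∀ᵐ x ∂μ, |b x| ≤ C)
    (hfl : Tendsto (fun n => eLpNorm (f n - f') 2 μ) atTop (nhds 0)) :
    Tendsto (fun n => eLpNorm ((fun x => b x * f n x) - fun x => b x * f' x) 2 μ)
      atTop (nhds 0) := by
  have h0 : Tendsto (fun n => ENNReal.ofReal C * eLpNorm (f n - f') 2 μ) atTop (nhds 0) := by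
    simpa using ENNReal.Tendsto.const_mul hfl (Or.inr ENNReal.ofReal_ne_top)
  refine tendsto_of_tendsto_of_tendsto_of_le_of_le tendsto_const_nhds h0 (fun _ => zero_le)
    fun n => ?_
  refine eLpNorm_le_mul_eLpNorm_of_ae_le_mul ?_ 2
  filter_upwards [hb] with x hx
  simp only [Pi.sub_apply, ← mul_sub, norm_mul]
  exact mul_le_mul_of_nonneg_right hx (norm_nonneg _)

open Filter in
theorem tendsto_integral_bdd_mul_mul {α : Type*} [MeasurableSpace α] {μ : Measure α}
    {f g : ℕ → α → ℝ} {f' g' b : α → ℝ} {C : ℝ} (hbm : AEStronglyMeasurable b μ)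
    (hb : ∀ᵐ x ∂μ, |b x| ≤ C) (hf : ∀ n, MemLp (f n) 2 μ) (hf' : MemLp f' 2 μ)
    (hg : ∀ n, MemLp (g n) 2 μ) (hg' : MemLp g' 2 μ)
    (hfl : Tendsto (fun n => eLpNorm (f n - f') 2 μ) atTop (nhds 0))
    (hgl : Tendsto (fun n => eLpNorm (g n - g') 2 μ) atTop (nhds 0)) :
    Tendsto (fun n => ∫ x, b x * f n x * g n x ∂μ) atTop (nhds (∫ x, b x * f' x * g' x ∂μ)) :=
  tendsto_integral_mul_of_tendsto_eLpNorm (fun n => (hf n).two_bdd_mul hbm hb)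
    (hf'.two_bdd_mul hbm hb) hg hg' (tendsto_eLpNorm_bdd_mul hb hfl) hgl

open Filter in
theorem tendsto_eLpNorm_tangential_sub {μ : Measure Plane} (x₀ : Plane)
    {V : ℕ → Fin 2 → Plane → ℝ} {V' : Fin 2 → Plane → ℝ}
    (hV : ∀ n i, MemLp (V n i) 2 μ) (hV' : ∀ i, MemLp (V' i) 2 μ)
    (h : ∀ i, Tendsto (fun n => eLpNorm (V n i - V' i) 2 μ) atTop (nhds 0)) :
    Tendsto (fun n => eLpNorm (tangential x₀ (V n) - tangential x₀ V') 2 μ) atTop (nhds 0) := by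
  have hb := fun i j => tendsto_eLpNorm_bdd_mul (ae_abs_radialUnit_le μ x₀ j) (h i)
  have hm := fun n i j => (MemLp.two_bdd_mul (C := 1) ((hV n i).sub (hV' i))
    (measurable_radialUnit_apply x₀ j).aestronglyMeasurable (ae_abs_radialUnit_le μ x₀ j)).1
  have h0 := (hb 1 0).add (hb 0 1)
  rw [add_zero] at h0
  refine tendsto_of_tendsto_of_tendsto_of_le_of_le tendsto_const_nhds h0 (fun _ => zero_le)
    fun n => ?_
  have e : tangential x₀ (V n) - tangential x₀ V'
      = (fun x => radialUnit x₀ x 0 * (V n 1 - V' 1) x)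
        - fun x => radialUnit x₀ x 1 * (V n 0 - V' 0) x := by
    ext x
    simp only [tangential, Pi.sub_apply]
    ring
  have e2 : ∀ i j, ((fun x => radialUnit x₀ x j * V n i x) - fun x => radialUnit x₀ x j * V' i x)
      = fun x => radialUnit x₀ x j * (V n i - V' i) x := by
    intro i j
    ext x
    simp only [Pi.sub_apply]
    ring
  rw [e, e2, e2]
  exact eLpNorm_sub_le (hm n 1 0) (hm n 0 1) (by norm_num)

open Filter in
/-- Integrated differential inequality for the energy on discs. -/
theorem setIntegral_primitive_mul_energyDensity_le {A : CoeffField} {lam Lam S : ℝ} {x₀ : Plane}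
    {R : ℝ} (h : IsEllipticOn A lam Lam (Metric.ball x₀ R)) {V : Fin 2 → Plane → ℝ}
    (hV : ∀ i, MemLp (V i) 2 (volume.restrict (Metric.ball x₀ R)))
    (hdiv : ∀ φ, IsTestFunction (Metric.ball x₀ R) φ →
      ∫ x in Metric.ball x₀ R, ∑ j, flux A V j x * classicalPartial j φ x = 0)
    (hS : ∀ᵐ r ∂volume.restrict (Set.Ioo 0 R), ∫ θ in Set.Ioc 0 (2 * Real.pi),
      quadForm A (x₀ + r • circlePoint θ) (circlePoint θ) ≤ S)
    {w : ℕ → Plane → ℝ} (hw : ∀ n, ContDiff ℝ ∞ (w n))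
    (hlim : ∀ i, Tendsto (fun n => eLpNorm (classicalPartial i (w n) - V i) 2
      (volume.restrict (Metric.ball x₀ R))) atTop (nhds 0))
    {g : ℝ → ℝ} {M : ℝ} (hgm : Measurable g) (hg0 : ∀ r, 0 ≤ g r) (hgM : ∀ r, g r ≤ M) :
    ∫ x in Metric.ball x₀ R, (∫ r in Set.Ioo ‖x - x₀‖ R, g r) * energyDensity A V x
      ≤ S / (4 * Real.pi)
        * ∫ x in Metric.ball x₀ R, g ‖x - x₀‖ * ‖x - x₀‖ * energyDensity A V x := by
  have hB : MeasurableSet (Metric.ball x₀ R) := measurableSet_ball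
  set μ := volume.restrict (Metric.ball x₀ R) with hμ
  have hgI : ∀ ρ, IntegrableOn g (Set.Ioo ρ R) := fun ρ =>
    Measure.integrableOn_of_bounded (M := M) (by simp) hgm.aestronglyMeasurable
      (Eventually.of_forall fun r => by rw [Real.norm_eq_abs, abs_of_nonneg (hg0 r)]; exact hgM r)
  have hF2 := memLp_flux hB h hV
  have hFn := memLp_radial_flux x₀ hF2
  have hpart : ∀ n i, MemLp (classicalPartial i (w n)) 2 μ := fun n i =>
    memLp_continuous_ball (continuous_classicalPartial (hw n) i)
  have hT := memLp_tangential x₀ hV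
  have hTn := fun n => memLp_tangential x₀ (hpart n)
  set H : Plane → ℝ := fun x => ∫ r in Set.Ioo ‖x - x₀‖ R, g r with hH
  have hHm : AEStronglyMeasurable H μ := by
    -- Since `g` is nonnegative, its integral from `ρ` to `R` is monotone in `ρ`, which gives
    -- measurability of `H` at no cost.
    have hanti : Antitone fun ρ => ∫ r in Set.Ioo ρ R, g r := fun ρ ρ' hρ =>
      setIntegral_mono_set (hgI ρ) (Eventually.of_forall hg0)
        (Set.Ioo_subset_Ioo_left hρ).eventuallyLE
    exact (hanti.measurable.comp (by fun_prop : Measurable fun x : Plane => ‖x - x₀‖)).aestronglyMeasurable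
  have hHb : ∀ᵐ x ∂μ, |H x| ≤ ∫ r in Set.Ioo 0 R, g r := by
    refine Eventually.of_forall fun x => ?_
    rw [abs_of_nonneg (integral_nonneg hg0)]
    exact setIntegral_mono_set (hgI 0) (Eventually.of_forall hg0)
      (Set.Ioo_subset_Ioo_left (norm_nonneg _)).eventuallyLE
  set m : Plane → ℝ := fun x => g ‖x - x₀‖ * ‖x - x₀‖ with hm
  have hmm : AEStronglyMeasurable m μ :=
    ((hgm.comp (by fun_prop : Measurable fun x : Plane => ‖x - x₀‖)).mul
      (by fun_prop)).aestronglyMeasurable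
  have hmb : ∀ᵐ x ∂μ, |m x| ≤ M * R := by
    filter_upwards [ae_restrict_mem hB] with x hx
    rw [abs_of_nonneg (mul_nonneg (hg0 _) (norm_nonneg _))]
    refine mul_le_mul (hgM _) ?_ (norm_nonneg _) ((hg0 0).trans (hgM 0))
    rw [← dist_eq_norm]
    exact (Metric.mem_ball.1 hx).le
  set b : Plane → ℝ := fun x => m x * (radialCoeff A x₀ x)⁻¹ with hb
  have hbm : AEStronglyMeasurable b μ := hmm.mul (aestronglyMeasurable_inv_radialCoeff h x₀)
  have hbb : ∀ᵐ x ∂μ, |b x| ≤ M * R * lam⁻¹ := by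
    filter_upwards [hmb, ae_abs_inv_radialCoeff_le hB h x₀] with x h1 h2
    rw [hb, abs_mul]
    exact mul_le_mul h1 h2 (abs_nonneg _) ((abs_nonneg _).trans h1)
  have hbsq : ∀ {f : Plane → ℝ}, MemLp f 2 μ → Integrable (fun x => b x * f x * f x) μ :=
    fun hf => (hf.two_bdd_mul hbm hbb).integrable_mul hf
  set Fn : Plane → ℝ := fun x => ∑ j, flux A V j x * radialUnit x₀ x j with hFndef
  have hmix : ∀ n x, m x * mixedDensity A x₀ (w n) V x
      = b x * tangential x₀ (fun i => classicalPartial i (w n)) x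
          * tangential x₀ (fun i => classicalPartial i (w n)) x + b x * Fn x * Fn x := by
    intro n x
    simp only [mixedDensity, hb, hFndef]
    ring
  have hmixI : ∀ n, IntegrableOn (fun x => m x * mixedDensity A x₀ (w n) V x)
      (Metric.ball x₀ R) := by
    intro n
    simp only [hmix]
    exact (hbsq (hTn n)).add (hbsq hFn)
  have hHF : ∀ j, MemLp (fun x => H x * flux A V j x) 2 μ := fun j =>
    (hF2 j).two_bdd_mul hHm hHb
  have hHFI : ∀ j {f : Plane → ℝ}, MemLp f 2 μ → Integrable (fun x => H x * flux A V j x * f x) μ :=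
    fun j _ hf => (hHF j).integrable_mul hf
  have hstep : ∀ n, ∑ j, ∫ x, H x * flux A V j x * classicalPartial j (w n) x ∂μ
      ≤ S / (4 * Real.pi) * ((∫ x, b x * tangential x₀ (fun i => classicalPartial i (w n)) x
          * tangential x₀ (fun i => classicalPartial i (w n)) x ∂μ)
        + ∫ x, b x * Fn x * Fn x ∂μ) := by
    intro n
    have hkI : IntegrableOn (fun x => ∑ j, flux A V j x * classicalPartial j (w n) x)
        (Metric.ball x₀ R) := integrable_finsetSum _ fun j _ =>
      integrableOn_ball_mul_continuous (memLp_two_ball_integrable (hF2 j))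
        (continuous_classicalPartial (hw n) j)
    have e1 : ∑ j, ∫ x, H x * flux A V j x * classicalPartial j (w n) x ∂μ
        = ∫ x in Metric.ball x₀ R, H x * ∑ j, flux A V j x * classicalPartial j (w n) x := by
      rw [← integral_finsetSum _ fun j _ => hHFI j (hpart n j)]
      refine integral_congr_ae (Eventually.of_forall fun x => ?_)
      simp only [Finset.mul_sum, mul_assoc]
    rw [e1, setIntegral_radial_primitive_mul hkI (hgI 0), ← integral_add (hbsq (hTn n)) (hbsq hFn)]
    simp only [← hmix]
    rw [setIntegral_ball_eq_polar (hmixI n), ← integral_const_mul]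
    refine integral_mono_ae (integrableOn_mul_setIntegral_ball hkI (hgI 0))
      ((integrableOn_polar (hmixI n)).const_mul _) ?_
    filter_upwards [ae_setIntegral_flux_le h hV hdiv hS (hw n), ae_restrict_mem measurableSet_Ioo]
      with r hr hr0
    refine (mul_le_mul_of_nonneg_left hr (hg0 r)).trans (le_of_eq ?_)
    simp only [hm, norm_polar_sub x₀ hr0.1]
    rw [integral_const_mul]
    ring
  -- The weights `H` and `b` are bounded, so $L^2$ convergence of the gradients suffices on both
  -- sides. Only the gradient of `w n` moves; the flux of `V` stays fixed.
  have hL : Tendsto (fun n => ∑ j, ∫ x, H x * flux A V j x * classicalPartial j (w n) x ∂μ) atTop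
      (nhds (∑ j, ∫ x, H x * flux A V j x * V j x ∂μ)) := by
    refine tendsto_finsetSum _ fun j _ => ?_
    refine tendsto_integral_mul_of_tendsto_eLpNorm (fun _ => hHF j) (hHF j) (fun n => hpart n j)
      (hV j) ?_ (hlim j)
    simp
  have hTl := tendsto_eLpNorm_tangential_sub x₀ hpart hV hlim
  have hRl := ((tendsto_integral_bdd_mul_mul hbm hbb hTn hT hTn hT hTl hTl).add_const
    (∫ x, b x * Fn x * Fn x ∂μ)).const_mul (S / (4 * Real.pi))
  have hfin := le_of_tendsto_of_tendsto' hL hRl hstep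
  have e2 : ∑ j, ∫ x, H x * flux A V j x * V j x ∂μ = ∫ x, H x * energyDensity A V x ∂μ := by
    rw [← integral_finsetSum _ fun j _ => hHFI j (hV j)]
    refine integral_congr_ae (Eventually.of_forall fun x => ?_)
    simp only [energyDensity, Finset.mul_sum, mul_assoc]
  have e3 : (∫ x, b x * tangential x₀ V x * tangential x₀ V x ∂μ) + ∫ x, b x * Fn x * Fn x ∂μ
      = ∫ x, m x * energyDensity A V x ∂μ := by
    rw [← integral_add (hbsq hT) (hbsq hFn)]
    refine integral_congr_ae ?_
    have hne : ∀ᵐ x ∂μ, x ≠ x₀ := ae_restrict_of_ae (Measure.ae_ne volume x₀)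
    filter_upwards [ae_restrict_mem hB, hne] with x hx hx0
    have ha : radialCoeff A x₀ x ≠ 0 := (h.pos.trans_le (radialCoeff_bounds h hx hx0).1).ne'
    have hsq := sq_tangential_add_sq_flux x₀ V (h.symm x hx) (h.det x hx)
    have : b x * tangential x₀ V x * tangential x₀ V x + b x * Fn x * Fn x
        = b x * (tangential x₀ V x ^ 2 + Fn x ^ 2) := by ring
    rw [this, hsq, hb]
    field_simp
  rw [e2, e3] at hfin
  exact hfin

/-! ### Energy decay with the sharp exponent -/

theorem integrableOn_energyDensity {A : CoeffField} {lam Lam : ℝ} {B : Set Plane}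
    (hB : MeasurableSet B) (h : IsEllipticOn A lam Lam B) {V : Fin 2 → Plane → ℝ}
    (hV : ∀ i, MemLp (V i) 2 (volume.restrict B)) : IntegrableOn (energyDensity A V) B :=
  integrable_finsetSum _ fun j _ => (memLp_flux hB h hV j).integrable_mul (hV j)

theorem integral_Ioo_rpow_neg {s R β : ℝ} (hs : 0 < s) (hsR : s ≤ R) (hβ : 0 < β) :
    ∫ r in Set.Ioo s R, r ^ (-β - 1) = (s ^ (-β) - R ^ (-β)) / β := by
  rw [← integral_Ioc_eq_integral_Ioo, ← intervalIntegral.integral_of_le hsR,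
    integral_rpow (Or.inr ⟨by linarith, fun h => by
      rw [Set.uIcc_of_le hsR] at h; exact absurd h.1 (not_le.2 hs)⟩)]
  rw [sub_add_cancel, div_neg, ← neg_div, neg_sub]

open Filter in
/-- Energy decay on concentric discs, with the sharp exponent. -/
theorem setIntegral_energyDensity_le_rpow {A : CoeffField} {lam Lam S : ℝ} {x₀ : Plane}
    {R : ℝ} (h : IsEllipticOn A lam Lam (Metric.ball x₀ R)) {V : Fin 2 → Plane → ℝ}
    (hV : ∀ i, MemLp (V i) 2 (volume.restrict (Metric.ball x₀ R)))
    (hdiv : ∀ φ, IsTestFunction (Metric.ball x₀ R) φ →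
      ∫ x in Metric.ball x₀ R, ∑ j, flux A V j x * classicalPartial j φ x = 0)
    (hS0 : 0 < S) (hS : ∀ᵐ r ∂volume.restrict (Set.Ioo 0 R), ∫ θ in Set.Ioc 0 (2 * Real.pi),
      quadForm A (x₀ + r • circlePoint θ) (circlePoint θ) ≤ S)
    {w : ℕ → Plane → ℝ} (hw : ∀ n, ContDiff ℝ ∞ (w n))
    (hlim : ∀ i, Tendsto (fun n => eLpNorm (classicalPartial i (w n) - V i) 2
      (volume.restrict (Metric.ball x₀ R))) atTop (nhds 0))
    {s : ℝ} (hs : 0 < s) (hsR : s ≤ R) :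
    ∫ x in Metric.ball x₀ s, energyDensity A V x
      ≤ (s / R) ^ (4 * Real.pi / S) * ∫ x in Metric.ball x₀ R, energyDensity A V x := by
  set β := 4 * Real.pi / S with hβ
  have hβ0 : 0 < β := by positivity
  have hB : MeasurableSet (Metric.ball x₀ R) := measurableSet_ball
  have hR : 0 < R := hs.trans_le hsR
  -- The integrating factor of $\beta E\le rE'$, cut off below `s` so that it is bounded.
  set g : ℝ → ℝ := (Set.Ici s).indicator fun r => r ^ (-β - 1) with hg
  have hgm : Measurable g := (by fun_prop : Measurable fun r : ℝ => r ^ (-β - 1)).indicator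
    measurableSet_Ici
  have hg0 : ∀ r, 0 ≤ g r := fun r => Set.indicator_nonneg (fun r hr =>
    Real.rpow_nonneg (hs.le.trans hr) _) r
  have hgM : ∀ r, g r ≤ s ^ (-β - 1) := fun r => by
    by_cases hr : r ∈ Set.Ici s
    · rw [hg, Set.indicator_of_mem hr]
      exact Real.rpow_le_rpow_of_nonpos hs hr (by linarith)
    · rw [hg, Set.indicator_of_notMem hr]
      positivity
  have hmain := setIntegral_primitive_mul_energyDensity_le h hV hdiv hS hw hlim hgm hg0 hgM
  have hEI := integrableOn_energyDensity hB h hV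
  set E := energyDensity A V
  have hprim : ∀ ρ, ρ < R → ∫ r in Set.Ioo ρ R, g r = ((max s ρ) ^ (-β) - R ^ (-β)) / β := by
    intro ρ hρ
    rw [hg, setIntegral_indicator measurableSet_Ici,
      ← integral_Ioo_rpow_neg (lt_max_of_lt_left hs) (max_le hsR hρ.le) hβ0]
    refine setIntegral_congr_set ?_
    have e : Set.Ioo ρ R ∩ Set.Ioi s = Set.Ioo (max s ρ) R := by
      ext r
      simp only [Set.mem_inter_iff, Set.mem_Ioo, Set.mem_Ioi, max_lt_iff]
      tauto
    rw [← e]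
    exact (Filter.EventuallyEq.refl _ _).inter Ioi_ae_eq_Ici.symm
  have hcoef : S / (4 * Real.pi) = 1 / β := by rw [hβ, one_div_div]
  set B' := Metric.ball x₀ s with hB'
  have hsub : B' ⊆ Metric.ball x₀ R := Metric.ball_subset_ball hsR
  -- For this weight $\beta\int_\rho^R g-g(\rho)\rho$ equals $s^{-\beta}-R^{-\beta}$ for $\rho<s$
  -- and $-R^{-\beta}$ for $\rho\ge s$. Integrating against the energy density therefore gives
  -- $s^{-\beta}E(s)\le R^{-\beta}E(R)$.
  have hpt : ∀ x ∈ Metric.ball x₀ R, β * ((∫ r in Set.Ioo ‖x - x₀‖ R, g r) * E x)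
      - g ‖x - x₀‖ * ‖x - x₀‖ * E x
      = s ^ (-β) * B'.indicator E x - R ^ (-β) * E x := by
    intro x hx
    have hxR : ‖x - x₀‖ < R := by rwa [← dist_eq_norm]
    rw [hprim _ hxR]
    by_cases hxs : x ∈ B'
    · have h1 : ‖x - x₀‖ < s := by rwa [← dist_eq_norm]
      rw [Set.indicator_of_mem hxs, max_eq_left h1.le, hg, Set.indicator_of_notMem (by simpa using h1)]
      field_simp
      ring
    · have h1 : s ≤ ‖x - x₀‖ := by
        rw [← dist_eq_norm]
        exact not_lt.1 hxs
      have h2 : 0 < ‖x - x₀‖ := hs.trans_le h1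
      rw [Set.indicator_of_notMem hxs, max_eq_right h1, hg, Set.indicator_of_mem (by simpa using h1),
        Real.rpow_sub_one h2.ne']
      field_simp
      ring
  have hI1 : IntegrableOn (fun x => s ^ (-β) * B'.indicator E x) (Metric.ball x₀ R) :=
    (hEI.indicator measurableSet_ball).const_mul _
  have hI2 : IntegrableOn (fun x => R ^ (-β) * E x) (Metric.ball x₀ R) := hEI.const_mul _
  have hI3 : IntegrableOn (fun x => g ‖x - x₀‖ * ‖x - x₀‖ * E x) (Metric.ball x₀ R) := by
    refine Integrable.bdd_mul (c := s ^ (-β - 1) * R) hEI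
      ((hgm.comp (by fun_prop : Measurable fun x : Plane => ‖x - x₀‖)).mul
        (by fun_prop)).aestronglyMeasurable ?_
    filter_upwards [ae_restrict_mem hB] with x hx
    rw [Real.norm_eq_abs, abs_of_nonneg (mul_nonneg (hg0 _) (norm_nonneg _))]
    refine mul_le_mul (hgM _) ?_ (norm_nonneg _) (by positivity)
    rw [← dist_eq_norm]
    exact (Metric.mem_ball.1 hx).le
  have hI4 : IntegrableOn (fun x => β * ((∫ r in Set.Ioo ‖x - x₀‖ R, g r) * E x))
      (Metric.ball x₀ R) := by
    refine ((hI3.add hI1).sub hI2).congr ?_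
    filter_upwards [ae_restrict_mem hB] with x hx
    have := hpt x hx
    simp only [Pi.add_apply, Pi.sub_apply]
    linarith
  have hint := setIntegral_congr_fun (μ := volume) hB hpt
  rw [integral_sub hI4 hI3, integral_sub hI1 hI2, integral_const_mul, integral_const_mul,
    integral_const_mul, setIntegral_indicator measurableSet_ball,
    Set.inter_eq_self_of_subset_right hsub] at hint
  rw [hcoef] at hmain
  have hm2 := mul_le_mul_of_nonneg_left hmain hβ0.le
  rw [← mul_assoc, mul_one_div_cancel hβ0.ne', one_mul] at hm2
  have hfin : s ^ (-β) * ∫ x in B', E x ≤ R ^ (-β) * ∫ x in Metric.ball x₀ R, E x := by linarith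
  rw [Real.rpow_neg hs.le, Real.rpow_neg hR.le] at hfin
  rw [Real.div_rpow hs.le hR.le]
  have hsp : 0 < s ^ β := Real.rpow_pos_of_pos hs _
  have := mul_le_mul_of_nonneg_left hfin hsp.le
  rw [← mul_assoc, mul_inv_cancel₀ hsp.ne', one_mul] at this
  calc _ ≤ _ := this
    _ = _ := by rw [div_eq_mul_inv]; ring

/-! ### Morrey estimate along cones of discs -/

/-- The integral of `z ↦ f (p + t z)` over the closed unit disc. -/
def diskIntegral (f : Plane → ℝ) (p : Plane) (t : ℝ) : ℝ :=
  ∫ z in Metric.closedBall (0 : Plane) 1, f (p + t • z)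

theorem diskIntegral_eq_setIntegral (f : Plane → ℝ) (p : Plane) {t : ℝ} (ht : 0 < t) :
    diskIntegral f p t = (t ^ 2)⁻¹ * ∫ x in Metric.closedBall p t, f x := by
  rw [diskIntegral, Measure.setIntegral_comp_smul_of_pos volume (fun x => f (p + x)) _ ht,
    smul_unitClosedBall_of_nonneg ht.le, smul_eq_mul]
  congr 1
  · simp
  · rw [← (measurePreserving_add_left volume p).setIntegral_preimage_emb
      (MeasurableEquiv.addLeft p).measurableEmbedding f (Metric.closedBall p t)]
    congr 2
    ext x
    simp [dist_eq_norm]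

theorem measureReal_closedBall_plane (p : Plane) {t : ℝ} (ht : 0 ≤ t) :
    volume.real (Metric.closedBall p t) = t ^ 2 * Real.pi := by
  rw [measureReal_def, EuclideanSpace.volume_closedBall_fin_two, ENNReal.toReal_mul,
    ENNReal.toReal_pow, ENNReal.toReal_ofReal ht, ENNReal.toReal_ofReal Real.pi_pos.le]

theorem diskIntegral_eq_average (f : Plane → ℝ) (p : Plane) {t : ℝ} (ht : 0 < t) :
    diskIntegral f p t = Real.pi * ⨍ x in Metric.closedBall p t, f x := by
  rw [diskIntegral_eq_setIntegral f p ht, setAverage_eq, measureReal_closedBall_plane p ht.le,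
    smul_eq_mul]
  field_simp

theorem memLp_continuous_closedBall {f : Plane → ℝ} (hf : Continuous f) (p : Plane) (t : ℝ) :
    MemLp f 2 (volume.restrict (Metric.closedBall p t)) :=
  (memLp_continuous_ball (x₀ := p) (R := t + 1) hf).mono_measure
    (Measure.restrict_mono_set _ (Metric.closedBall_subset_ball (by linarith)))

/-- Cauchy–Schwarz on a disc of area $\pi t^2$. -/
theorem setIntegral_abs_closedBall_le {f : Plane → ℝ} (hf : Continuous f) (p : Plane) {t : ℝ}
    (ht : 0 ≤ t) :
    ∫ x in Metric.closedBall p t, |f x|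
      ≤ (eLpNorm f 2 (volume.restrict (Metric.closedBall p t))).toReal * (t * √Real.pi) := by
  have h1 := eLpNorm_le_eLpNorm_mul_rpow_measure_univ (p := 1) (q := 2) (by norm_num)
    (hf.aestronglyMeasurable (μ := volume.restrict (Metric.closedBall p t)))
  have hfin : eLpNorm f 2 (volume.restrict (Metric.closedBall p t)) ≠ ⊤ :=
    (memLp_continuous_closedBall hf p t).eLpNorm_ne_top
  have hvol : volume.restrict (Metric.closedBall p t) Set.univ
      ^ (1 / (1 : ℝ≥0∞).toReal - 1 / (2 : ℝ≥0∞).toReal) = ENNReal.ofReal (t * √Real.pi) := by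
    rw [Measure.restrict_apply_univ, EuclideanSpace.volume_closedBall_fin_two,
      ← ENNReal.ofReal_pow ht, ← ENNReal.ofReal_mul (by positivity),
      ENNReal.ofReal_rpow_of_nonneg (by positivity) (by norm_num)]
    congr 1
    have : (1 / (1 : ℝ≥0∞).toReal - 1 / (2 : ℝ≥0∞).toReal) = 1 / 2 := by norm_num
    rw [this, ← Real.sqrt_eq_rpow, Real.sqrt_mul (by positivity), Real.sqrt_sq ht]
  rw [hvol] at h1
  have h2 := ENNReal.toReal_mono (ENNReal.mul_ne_top hfin ENNReal.ofReal_ne_top) h1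
  rw [ENNReal.toReal_mul, ENNReal.toReal_ofReal (by positivity), eLpNorm_one_eq_lintegral_enorm] at h2
  simpa only [← Real.norm_eq_abs, integral_norm_eq_lintegral_enorm hf.aestronglyMeasurable] using h2

theorem fderiv_apply_eq_sum (w : Plane → ℝ) (x ξ : Plane) :
    fderiv ℝ w x ξ = ∑ i, ξ i * classicalPartial i w x := by
  have e : ξ = ∑ i, ξ i • EuclideanSpace.single i (1 : ℝ) := by
    ext j
    fin_cases j <;> simp
  conv_lhs => rw [e]
  simp [classicalPartial]

/-- Morrey-type estimate along a cone of discs, for smooth functions. -/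
theorem abs_diskIntegral_sub_le {w : Plane → ℝ} (hw : ContDiff ℝ ∞ w) (x : Plane) {v : Plane}
    (hv : ‖v‖ ≤ 1) {δ ρ : ℝ} (hδ : 0 < δ) (hδρ : δ ≤ ρ) {N : ℝ → ℝ}
    (hN : ∀ t ∈ Set.Icc δ ρ, ∀ i, (eLpNorm (classicalPartial i w) 2
      (volume.restrict (Metric.closedBall (x + t • v) t))).toReal ≤ N t)
    (hNI : IntervalIntegrable (fun t => N t / t) volume δ ρ) :
    |diskIntegral w (x + ρ • v) ρ - diskIntegral w (x + δ • v) δ|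
      ≤ 4 * √Real.pi * ∫ t in δ..ρ, N t / t := by
  set D := Metric.closedBall (0 : Plane) 1 with hD
  have hDc : IsCompact D := isCompact_closedBall _ _
  have hDm : MeasurableSet D := Metric.isClosed_closedBall.measurableSet
  set γ : Plane → ℝ → Plane := fun z t => x + t • v + t • z with hγ
  -- Along `γ z` the velocity is `v + z`, of norm at most $2$; hence the factor $2$. Together with
  -- the two partial derivatives it yields the $4$ in the statement.
  set G : Plane → ℝ → ℝ := fun z t => 2 * ∑ i, |classicalPartial i w (γ z t)| with hG
  have hpc := fun i => continuous_classicalPartial hw i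
  have hGc : Continuous (Function.uncurry G) := by
    simp only [hG, hγ, Function.uncurry_def]
    refine continuous_const.mul (continuous_finsetSum _ fun i _ => ?_)
    exact ((hpc i).comp (by fun_prop)).abs
  have hwc := hw.continuous
  have hI : ∀ t : ℝ, IntegrableOn (fun z => w (x + t • v + t • z)) D := fun t =>
    (by fun_prop : Continuous fun z : Plane => w (x + t • v + t • z)).continuousOn.integrableOn_compact hDc
  have hpt : ∀ z ∈ D, |w (γ z ρ) - w (γ z δ)| ≤ ∫ t in Set.Ioc δ ρ, G z t := by
    intro z hz
    have hder : ∀ t, HasDerivAt (fun t => w (γ z t)) (fderiv ℝ w (γ z t) (v + z)) t := by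
      intro t
      have h1 : HasDerivAt (γ z) (v + z) t := by
        have := (((hasDerivAt_id t).smul_const v).const_add x).add ((hasDerivAt_id t).smul_const z)
        simpa [hγ] using! this
      exact ((hw.differentiable (by simp) (γ z t)).hasFDerivAt).comp_hasDerivAt t h1
    have hc : Continuous fun t => fderiv ℝ w (γ z t) (v + z) := by
      have := hw.continuous_fderiv (by simp)
      exact (this.comp (by fun_prop : Continuous (γ z))).clm_apply continuous_const
    rw [← intervalIntegral.integral_eq_sub_of_hasDerivAt (fun t _ => hder t)
      (hc.intervalIntegrable _ _), intervalIntegral.integral_of_le hδρ]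
    refine abs_integral_le_integral_abs.trans ?_
    have hGz : Continuous (G z) := hGc.uncurry_left z
    refine setIntegral_mono hc.abs.integrableOn_Ioc hGz.integrableOn_Ioc fun t => ?_
    have hvz : ∀ i, |(v + z) i| ≤ 2 := fun i => by
      refine (abs_coord_le_norm _ i).trans ((norm_add_le _ _).trans ?_)
      have : ‖z‖ ≤ 1 := mem_closedBall_zero_iff.1 hz
      linarith
    simp only [fderiv_apply_eq_sum, hG, Finset.mul_sum]
    refine (Finset.abs_sum_le_sum_abs _ _).trans (Finset.sum_le_sum fun i _ => ?_)
    rw [abs_mul]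
    exact mul_le_mul_of_nonneg_right (hvz i) (abs_nonneg _)
  have hGI : Integrable (Function.uncurry G)
      ((volume.restrict D).prod (volume.restrict (Set.Ioc δ ρ))) := by
    rw [Measure.prod_restrict, ← Measure.volume_eq_prod]
    exact (hGc.continuousOn.integrableOn_compact (hDc.prod isCompact_Icc)).mono_set
      (Set.prod_mono le_rfl Set.Ioc_subset_Icc_self)
  have h1 : |diskIntegral w (x + ρ • v) ρ - diskIntegral w (x + δ • v) δ|
      ≤ ∫ z in D, ∫ t in Set.Ioc δ ρ, G z t := by
    rw [diskIntegral, diskIntegral, ← integral_sub (hI ρ) (hI δ)]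
    refine abs_integral_le_integral_abs.trans ?_
    refine setIntegral_mono_on ((hI ρ).sub (hI δ)).abs hGI.integral_prod_left hDm hpt
  refine h1.trans ?_
  rw [integral_integral_swap hGI, ← intervalIntegral.integral_of_le hδρ,
    ← intervalIntegral.integral_const_mul]
  refine intervalIntegral.integral_mono_on hδρ ?_ (hNI.const_mul _) fun t ht => ?_
  · rw [intervalIntegrable_iff_integrableOn_Ioc_of_le hδρ]
    exact hGI.integral_prod_right
  · have ht0 : 0 < t := hδ.trans_le ht.1
    have hint : ∀ i, IntegrableOn (fun z => |classicalPartial i w (γ z t)|) D := fun i =>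
      (((hpc i).comp (by fun_prop : Continuous fun z => γ z t)).abs).continuousOn.integrableOn_compact
        hDc
    have hi : ∀ i, ∫ z in D, |classicalPartial i w (γ z t)| ≤ √Real.pi * (N t / t) := by
      intro i
      have e := diskIntegral_eq_setIntegral (fun p => |classicalPartial i w p|) (x + t • v) ht0
      rw [diskIntegral] at e
      change ∫ z in D, |classicalPartial i w (x + t • v + t • z)| ≤ _
      rw [e]
      have h2 := (setIntegral_abs_closedBall_le (hpc i) (x + t • v) ht0.le).trans
        (mul_le_mul_of_nonneg_right (hN t ht i) (by positivity))
      calc _ ≤ (t ^ 2)⁻¹ * (N t * (t * √Real.pi)) := mul_le_mul_of_nonneg_left h2 (by positivity)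
        _ = _ := by field_simp
    simp only [hG, integral_const_mul]
    rw [integral_finsetSum _ fun i _ => hint i]
    have := Finset.sum_le_sum fun i (_ : i ∈ Finset.univ) => hi i
    simp only [Finset.sum_const, Finset.card_univ, Fintype.card_fin, nsmul_eq_mul] at this
    push_cast at this
    linarith

open Filter in
theorem tendsto_diskIntegral {U : Set Plane} {w : ℕ → Plane → ℝ} {u : Plane → ℝ}
    (hw : ∀ n, Continuous (w n)) (hu : MemLp u 2 (volume.restrict U))
    (hlim : Tendsto (fun n => eLpNorm (w n - u) 2 (volume.restrict U)) atTop (nhds 0))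
    {p : Plane} {t : ℝ} (ht : 0 < t) (hU : Metric.closedBall p t ⊆ U) :
    Tendsto (fun n => diskIntegral (w n) p t) atTop (nhds (diskIntegral u p t)) := by
  simp only [diskIntegral_eq_setIntegral _ p ht]
  refine Tendsto.const_mul _ ?_
  set μ := volume.restrict (Metric.closedBall p t)
  have hμ : μ ≤ volume.restrict U := Measure.restrict_mono_set _ hU
  have hfin : IsFiniteMeasure μ := ⟨by
    simpa [μ] using (isCompact_closedBall p t).measure_lt_top (μ := volume)⟩
  have hone : MemLp (fun _ : Plane => (1 : ℝ)) 2 μ := memLp_const 1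
  have hlim' : Tendsto (fun n => eLpNorm (w n - u) 2 μ) atTop (nhds 0) :=
    tendsto_of_tendsto_of_tendsto_of_le_of_le tendsto_const_nhds hlim (fun _ => zero_le)
      fun n => eLpNorm_mono_measure _ hμ
  have := tendsto_integral_mul_of_tendsto_eLpNorm (μ := μ) (f := w) (g := fun _ _ => 1) (f' := u)
    (g' := fun _ => 1)
    (fun n => memLp_continuous_closedBall (hw n) p t)
    (hu.mono_measure hμ) (fun _ => hone) hone hlim' (by simp)
  simpa using this

theorem integral_rpow_div_le {α δ ρ C ε : ℝ} (hα : 0 < α) (hδ : 0 < δ) (hδρ : δ ≤ ρ)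
    (hC : 0 ≤ C) :
    ∫ t in δ..ρ, (C * t ^ α + ε) / t ≤ C * ρ ^ α / α + ε * Real.log (ρ / δ) := by
  have hpos : ∀ t ∈ Set.uIcc δ ρ, 0 < t := fun t ht => by
    rw [Set.uIcc_of_le hδρ] at ht
    exact hδ.trans_le ht.1
  have h0 : (0 : ℝ) ∉ Set.uIcc δ ρ := fun h => (hpos 0 h).false
  have e : ∫ t in δ..ρ, (C * t ^ α + ε) / t = ∫ t in δ..ρ, (C * t ^ (α - 1) + ε * t⁻¹) := by
    refine intervalIntegral.integral_congr fun t ht => ?_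
    rw [Real.rpow_sub_one (hpos t ht).ne']
    field_simp
  have hI1 : IntervalIntegrable (fun t : ℝ => t ^ (α - 1)) volume δ ρ :=
    intervalIntegral.intervalIntegrable_rpow (Or.inr h0)
  have hI2 : IntervalIntegrable (fun t : ℝ => t⁻¹) volume δ ρ :=
    intervalIntegral.intervalIntegrable_inv (fun t ht => (hpos t ht).ne') continuousOn_id
  rw [e, intervalIntegral.integral_add (hI1.const_mul _) (hI2.const_mul _),
    intervalIntegral.integral_const_mul, intervalIntegral.integral_const_mul,
    integral_inv h0, integral_rpow (Or.inl (by linarith)), sub_add_cancel]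
  have : 0 ≤ δ ^ α := by positivity
  have h3 : C * ((ρ ^ α - δ ^ α) / α) ≤ C * ρ ^ α / α := by
    rw [mul_div_assoc]
    gcongr
    linarith
  linarith

open Filter in
/-- Morrey-type estimate along a cone of discs. -/
theorem abs_diskIntegral_sub_le_rpow {U : Set Plane} {w : ℕ → Plane → ℝ} {u : Plane → ℝ}
    {V : Fin 2 → Plane → ℝ} (hw : ∀ n, ContDiff ℝ ∞ (w n)) (hu : MemLp u 2 (volume.restrict U))
    (hV : ∀ i, MemLp (V i) 2 (volume.restrict U))
    (hlim : Tendsto (fun n => eLpNorm (w n - u) 2 (volume.restrict U)) atTop (nhds 0))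
    (hlim' : ∀ i, Tendsto (fun n => eLpNorm (classicalPartial i (w n) - V i) 2
      (volume.restrict U)) atTop (nhds 0))
    {x v : Plane} (hv : ‖v‖ ≤ 1) {δ ρ α C : ℝ} (hδ : 0 < δ) (hδρ : δ ≤ ρ) (hα : 0 < α)
    (hC : 0 ≤ C) (hU : ∀ t ∈ Set.Icc δ ρ, Metric.closedBall (x + t • v) t ⊆ U)
    (hdec : ∀ t ∈ Set.Icc δ ρ, ∀ i, eLpNorm (V i) 2
      (volume.restrict (Metric.closedBall (x + t • v) t)) ≤ ENNReal.ofReal (C * t ^ α)) :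
    |diskIntegral u (x + ρ • v) ρ - diskIntegral u (x + δ • v) δ|
      ≤ 4 * √Real.pi * (C * ρ ^ α / α) := by
  -- The decay is known for `V`, not for the gradients of the approximations, which therefore carry
  -- an error `ε n`. It costs `ε n * log (ρ / δ)`, harmless when `n` tends to infinity with `δ`
  -- fixed.
  set ε : ℕ → ℝ := fun n => ∑ i, (eLpNorm (classicalPartial i (w n) - V i) 2
    (volume.restrict U)).toReal with hε
  have hεlim : Tendsto ε atTop (nhds 0) := by
    have : Tendsto ε atTop (nhds (∑ _i : Fin 2, (0 : ℝ≥0∞).toReal)) :=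
      tendsto_finsetSum _ fun i _ => (ENNReal.tendsto_toReal ENNReal.zero_ne_top).comp (hlim' i)
    simpa using this
  have hfinite : ∀ᶠ n in atTop, ∀ i, eLpNorm (classicalPartial i (w n) - V i) 2
      (volume.restrict U) < ⊤ :=
    eventually_all.2 fun i => (hlim' i).eventually (gt_mem_nhds ENNReal.zero_lt_top)
  have hstep : ∀ᶠ n in atTop, |diskIntegral (w n) (x + ρ • v) ρ - diskIntegral (w n) (x + δ • v) δ|
      ≤ 4 * √Real.pi * (C * ρ ^ α / α + ε n * Real.log (ρ / δ)) := by
    filter_upwards [hfinite] with n hn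
    refine (abs_diskIntegral_sub_le (hw n) x hv hδ hδρ (N := fun t => C * t ^ α + ε n) ?_ ?_).trans ?_
    · intro t ht i
      have ht0 : 0 < t := hδ.trans_le ht.1
      set μ := volume.restrict (Metric.closedBall (x + t • v) t)
      have hμ : μ ≤ volume.restrict U := Measure.restrict_mono_set _ (hU t ht)
      have hVm := ((hV i).mono_measure hμ).1
      have hpm : AEStronglyMeasurable (classicalPartial i (w n)) μ :=
        (continuous_classicalPartial (hw n) i).aestronglyMeasurable
      have h1 : eLpNorm (classicalPartial i (w n)) 2 μ
          ≤ eLpNorm (V i) 2 μ + eLpNorm (classicalPartial i (w n) - V i) 2 (volume.restrict U) := by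
        calc eLpNorm (classicalPartial i (w n)) 2 μ
            = eLpNorm (V i + (classicalPartial i (w n) - V i)) 2 μ := by rw [add_sub_cancel]
          _ ≤ eLpNorm (V i) 2 μ + eLpNorm (classicalPartial i (w n) - V i) 2 μ :=
              eLpNorm_add_le hVm (hpm.sub hVm) (by norm_num)
          _ ≤ _ := add_le_add le_rfl (eLpNorm_mono_measure _ hμ)
      have h2 := h1.trans (add_le_add (hdec t ht i) le_rfl)
      have h3 := ENNReal.toReal_mono (ENNReal.add_ne_top.2 ⟨ENNReal.ofReal_ne_top, (hn i).ne⟩) h2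
      rw [ENNReal.toReal_add ENNReal.ofReal_ne_top (hn i).ne,
        ENNReal.toReal_ofReal (by positivity)] at h3
      refine h3.trans (add_le_add le_rfl ?_)
      exact Finset.single_le_sum (f := fun i => (eLpNorm (classicalPartial i (w n) - V i) 2
        (volume.restrict U)).toReal) (fun _ _ => ENNReal.toReal_nonneg) (Finset.mem_univ i)
    · refine ContinuousOn.intervalIntegrable fun t ht => ContinuousAt.continuousWithinAt ?_
      rw [Set.uIcc_of_le hδρ] at ht
      have ht0 : t ≠ 0 := (hδ.trans_le ht.1).ne'
      exact ((continuousAt_const.mul (Real.continuousAt_rpow_const t α (Or.inl ht0))).add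
        continuousAt_const).div continuousAt_id ht0
    · exact mul_le_mul_of_nonneg_left (integral_rpow_div_le hα hδ hδρ hC) (by positivity)
  have hL := ((tendsto_diskIntegral (fun n => (hw n).continuous) hu hlim (hδ.trans_le hδρ)
    (hU ρ (Set.right_mem_Icc.2 hδρ))).sub (tendsto_diskIntegral (fun n => (hw n).continuous) hu hlim
      hδ (hU δ (Set.left_mem_Icc.2 hδρ)))).abs
  have hR := ((hεlim.mul_const (Real.log (ρ / δ))).const_add (C * ρ ^ α / α)).const_mul
    (4 * √Real.pi)
  rw [zero_mul, add_zero] at hR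
  exact le_of_tendsto_of_tendsto hL hR hstep

open Filter in
/-- Integral characterisation of Hölder continuity: the almost everywhere version. -/
theorem exists_null_abs_sub_le {z : Plane} {ρ₀ R α C : ℝ} (hR : 2 * ρ₀ < R)
    {w : ℕ → Plane → ℝ} {u : Plane → ℝ} {V : Fin 2 → Plane → ℝ} (hw : ∀ n, ContDiff ℝ ∞ (w n))
    (hu : MemLp u 2 (volume.restrict (Metric.ball z R)))
    (hV : ∀ i, MemLp (V i) 2 (volume.restrict (Metric.ball z R)))
    (hlim : Tendsto (fun n => eLpNorm (w n - u) 2 (volume.restrict (Metric.ball z R))) atTop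
      (nhds 0))
    (hlim' : ∀ i, Tendsto (fun n => eLpNorm (classicalPartial i (w n) - V i) 2
      (volume.restrict (Metric.ball z R))) atTop (nhds 0))
    (hα : 0 < α) (hC : 0 ≤ C)
    (hdec : ∀ p ∈ Metric.ball z ρ₀, ∀ t, 0 < t → t ≤ ρ₀ → ∀ i, eLpNorm (V i) 2
      (volume.restrict (Metric.closedBall p t)) ≤ ENNReal.ofReal (C * t ^ α)) :
    ∃ N : Set Plane, volume N = 0 ∧
      ∀ x ∈ Metric.ball z ρ₀ \ N, ∀ y ∈ Metric.ball z ρ₀ \ N,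
        |u x - u y| ≤ 8 * √Real.pi / (Real.pi * α) * C * dist x y ^ α := by
  have hloc : LocallyIntegrable ((Metric.ball z R).indicator u) volume := by
    have : IntegrableOn u (Metric.ball z R) := memLp_two_ball_integrable hu
    exact (this.integrable_indicator measurableSet_ball).locallyIntegrable
  -- Lebesgue differentiation is needed along discs that contain `x` without being centred at it: as
  -- $\|v\|\le1$, the disc of radius `δ` about `x + δ • v` contains `x`, hence the constant `1`. The
  -- null set `N` is the exceptional set of this statement.
  have hae := IsUnifLocDoublingMeasure.ae_tendsto_average (μ := (volume : Measure Plane)) hloc 1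
  refine ⟨_, hae, ?_⟩
  have hleb : ∀ x ∈ Metric.ball z ρ₀, (∀ {ι : Type} {l : Filter ι} (w : ι → Plane) (δ : ι → ℝ),
      Tendsto δ l (nhdsWithin 0 (Set.Ioi 0)) → (∀ᶠ j in l, x ∈ Metric.closedBall (w j) (1 * δ j)) →
      Tendsto (fun j => ⨍ y in Metric.closedBall (w j) (δ j), (Metric.ball z R).indicator u y) l
        (nhds ((Metric.ball z R).indicator u x))) → ∀ v : Plane, ‖v‖ ≤ 1 →
      Tendsto (fun δ => diskIntegral u (x + δ • v) δ) (nhdsWithin 0 (Set.Ioi 0))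
        (nhds (Real.pi * u x)) := by
    intro x hx h v hv
    have hxz := Metric.mem_ball.1 hx
    have hρ0 : 0 < ρ₀ := dist_nonneg.trans_lt hxz
    have h1 := h (l := nhdsWithin 0 (Set.Ioi 0)) (fun δ : ℝ => x + δ • v) id tendsto_id (by
      filter_upwards [self_mem_nhdsWithin] with δ hδ
      have hδ' : (0 : ℝ) < δ := hδ
      rw [Metric.mem_closedBall, dist_eq_norm, sub_add_cancel_left, norm_neg, norm_smul,
        Real.norm_eq_abs, abs_of_pos hδ', one_mul]
      exact mul_le_of_le_one_right hδ'.le hv)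
    have hxR : x ∈ Metric.ball z R := Metric.ball_subset_ball (by linarith) hx
    rw [Set.indicator_of_mem hxR] at h1
    refine (h1.const_mul Real.pi).congr' ?_
    filter_upwards [Ioo_mem_nhdsGT (half_pos hρ0)] with δ hδ
    rw [diskIntegral_eq_average _ _ hδ.1]
    congr 1
    simp only [id]
    refine setAverage_congr_fun Metric.isClosed_closedBall.measurableSet ?_
    refine Eventually.of_forall fun y hy => Set.indicator_of_mem ?_ u
    have h2 := Metric.mem_closedBall.1 hy
    have h3 : dist (x + δ • v) x ≤ δ := by
      rw [dist_eq_norm, add_sub_cancel_left, norm_smul, Real.norm_eq_abs, abs_of_pos hδ.1]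
      exact mul_le_of_le_one_right hδ.1.le hv
    rw [Metric.mem_ball]
    have h4 := dist_triangle4 y (x + δ • v) x z
    linarith [hδ.2]
  intro x hx y hy
  by_cases hxy : x = y
  · simp [hxy, Real.zero_rpow hα.ne']
  set ρ := dist x y / 2 with hρ
  have hρ0 : 0 < ρ := half_pos (dist_pos.2 hxy)
  have hhalf : ∀ a ∈ Metric.ball z ρ₀, ∀ b ∈ Metric.ball z ρ₀, dist a b / 2 = ρ →
      ∀ v : Plane, (2 * ρ) • v = b - a → ‖v‖ ≤ 1 →
      Tendsto (fun δ => diskIntegral u (a + δ • v) δ) (nhdsWithin 0 (Set.Ioi 0))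
        (nhds (Real.pi * u a)) →
      |diskIntegral u (a + ρ • v) ρ - Real.pi * u a| ≤ 4 * √Real.pi * (C * ρ ^ α / α) := by
    intro a ha b hb hab v hvab hv hlimv
    have hρρ₀ : ρ < ρ₀ := by
      have := dist_triangle_right a b z
      have h1 := Metric.mem_ball.1 ha
      have h2 := Metric.mem_ball.1 hb
      linarith
    have hmem : ∀ t, 0 ≤ t → t ≤ ρ → a + t • v ∈ Metric.ball z ρ₀ := by
      intro t ht0 ht
      have e : a + t • v = a + (t / (2 * ρ)) • (b - a) := by
        rw [← hvab, smul_smul, div_mul_cancel₀ _ (by positivity)]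
      rw [e]
      exact (convex_ball z ρ₀).add_smul_sub_mem ha hb ⟨by positivity, by
        rw [div_le_one (by positivity)]; linarith⟩
    refine le_of_tendsto (hlimv.const_sub _).abs ?_
    filter_upwards [Ioo_mem_nhdsGT hρ0] with δ hδ
    refine abs_diskIntegral_sub_le_rpow hw hu hV hlim hlim' hv hδ.1 hδ.2.le hα hC ?_ ?_
    · intro t ht
      have ht0 : 0 < t := hδ.1.trans_le ht.1
      refine Metric.closedBall_subset_ball' ?_
      have := Metric.mem_ball.1 (hmem t ht0.le ht.2)
      linarith [ht.2]
    · intro t ht i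
      have ht0 : 0 < t := hδ.1.trans_le ht.1
      exact hdec _ (hmem t ht0.le ht.2) t ht0 (ht.2.trans hρρ₀.le) i
  -- With `2 * ρ = dist x y`, the cone from `x` in direction `v` and the cone from `y` in direction
  -- `-v` end in the same disc, of radius `ρ` about the midpoint. Adding the two estimates doubles
  -- $4\sqrt\pi$.
  set v : Plane := (2 * ρ)⁻¹ • (y - x) with hv
  have hv1 : ‖v‖ ≤ 1 := by
    rw [hv, norm_smul, norm_inv, Real.norm_eq_abs, abs_of_pos (by positivity), ← dist_eq_norm,
      dist_comm y x, hρ, mul_div_cancel₀ _ two_ne_zero]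
    exact inv_mul_le_one
  have hvs : (2 * ρ) • v = y - x := by
    rw [hv, smul_smul, mul_inv_cancel₀ (by positivity), one_smul]
  have h1 := hhalf x hx.1 y hy.1 rfl v hvs hv1
    (hleb x hx.1 (fun {ι l} => not_not.1 hx.2 (ι := ι) (l := l)) v hv1)
  have h2 := hhalf y hy.1 x hx.1 (by rw [dist_comm]) (-v) (by rw [smul_neg, hvs, neg_sub])
    (by rwa [norm_neg]) (hleb y hy.1 (fun {ι l} => not_not.1 hy.2 (ι := ι) (l := l)) (-v)
      (by rwa [norm_neg]))
  have hmid : y + ρ • (-v) = x + ρ • v := by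
    have : y = x + (2 * ρ) • v := by rw [hvs, add_sub_cancel]
    rw [this, smul_neg, add_assoc, ← sub_eq_add_neg, ← sub_smul]
    congr 2
    ring
  rw [hmid] at h2
  have hρα : ρ ^ α ≤ dist x y ^ α :=
    Real.rpow_le_rpow hρ0.le (by rw [hρ]; linarith [dist_nonneg (x := x) (y := y)]) hα.le
  have h3 : |Real.pi * u x - Real.pi * u y| ≤ 8 * √Real.pi * (C * ρ ^ α / α) := by
    have := abs_sub_le (Real.pi * u x) (diskIntegral u (x + ρ • v) ρ) (Real.pi * u y)
    rw [abs_sub_comm (Real.pi * u x) (diskIntegral u (x + ρ • v) ρ)] at this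
    linarith
  rw [← mul_sub, abs_mul, abs_of_pos Real.pi_pos] at h3
  have h4 : |u x - u y| ≤ 8 * √Real.pi * (C * ρ ^ α / α) / Real.pi := by
    rw [le_div_iff₀ Real.pi_pos]
    linarith
  refine h4.trans ?_
  calc _ = 8 * √Real.pi / (Real.pi * α) * C * ρ ^ α := by field_simp
    _ ≤ _ := by gcongr

/-! ### From local bounds to a Hölder representative -/

/-- Local Hölder bounds off null sets give a locally Hölder continuous representative. -/
theorem isLocallyHolder_of_local_bounds {Ω : Set Plane} {α : ℝ} (hα : 0 < α) {u : Plane → ℝ}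
    (hΩ : MeasurableSet Ω)
    (h : ∀ z ∈ Ω, ∃ ρ > 0, ∃ C : ℝ, ∃ N : Set Plane, volume N = 0 ∧
      ∀ x ∈ Metric.ball z ρ \ N, ∀ y ∈ Metric.ball z ρ \ N, |u x - u y| ≤ C * dist x y ^ α) :
    IsLocallyHolder Ω α u := by
  have h' : ∀ z : Ω, ∃ ρ > 0, ∃ C : ℝ, ∃ N : Set Plane, volume N = 0 ∧
      ∀ x ∈ Metric.ball (z : Plane) ρ \ N, ∀ y ∈ Metric.ball (z : Plane) ρ \ N,
        |u x - u y| ≤ C * dist x y ^ α := fun z => h z z.2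
  choose ρ hρ C N hN hbd using h'
  -- By the Lindelöf property countably many discs suffice, so the union of their exceptional sets
  -- is null and its complement `G` is dense.
  obtain ⟨T, hT, hTU⟩ := TopologicalSpace.isOpen_iUnion_countable
    (fun z : Ω => Metric.ball (z : Plane) (ρ z)) (fun z => Metric.isOpen_ball)
  set G : Set Plane := (⋃ z ∈ T, N z)ᶜ with hG
  have hGnull : volume (⋃ z ∈ T, N z) = 0 := (measure_biUnion_null_iff hT).2 fun z _ => hN z
  have hGae : ∀ᵐ x ∂(volume : Measure Plane), x ∈ G := measure_eq_zero_iff_ae_notMem.1 hGnull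
  have hGdense : Dense G := Measure.dense_of_ae hGae
  have hloc : ∀ x ∈ Ω, ∃ U : Set Plane, IsOpen U ∧ x ∈ U ∧ ∃ C : ℝ,
      ∀ a ∈ U ∩ G, ∀ b ∈ U ∩ G, |u a - u b| ≤ C * dist a b ^ α := by
    intro x hx
    have : x ∈ ⋃ z : Ω, Metric.ball (z : Plane) (ρ z) :=
      Set.mem_iUnion.2 ⟨⟨x, hx⟩, Metric.mem_ball_self (hρ _)⟩
    rw [← hTU] at this
    obtain ⟨z, hz, hxz⟩ := Set.mem_iUnion₂.1 this
    have hsub : ∀ a ∈ Metric.ball (z : Plane) (ρ z) ∩ G, a ∈ Metric.ball (z : Plane) (ρ z) \ N z :=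
      fun a ha => ⟨ha.1, fun haN => ha.2 (Set.mem_iUnion₂.2 ⟨z, hz, haN⟩)⟩
    exact ⟨_, Metric.isOpen_ball, hxz, C z, fun a ha b hb => hbd z a (hsub a ha) b (hsub b hb)⟩
  have hne : ∀ x : Plane, (nhdsWithin x G).NeBot := fun x =>
    mem_closure_iff_nhdsWithin_neBot.1 (hGdense x)
  have hpow : ∀ (C : ℝ) (x : Plane), Filter.Tendsto (fun p : Plane × Plane => C * dist p.1 p.2 ^ α)
      (nhds (x, x)) (nhds 0) := by
    intro C x
    have hc : Continuous fun p : Plane × Plane => C * dist p.1 p.2 ^ α :=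
      continuous_const.mul ((continuous_fst.dist continuous_snd).rpow_const fun _ => Or.inr hα.le)
    simpa [Real.zero_rpow hα.ne'] using hc.tendsto (x, x)
  -- The Hölder bound on `G` makes `u` Cauchy along `G` at every point of `Ω`, so `extendFrom G u`
  -- is a genuine limit there; local bounds then pass to it by closure.
  have hlim : ∀ x ∈ Ω, Filter.Tendsto u (nhdsWithin x G) (nhds (extendFrom G u x)) := by
    intro x hx
    have := hne x
    obtain ⟨U, hU, hxU, C, hC⟩ := hloc x hx
    refine tendsto_extendFrom (cauchy_map_iff_exists_tendsto.1 (cauchy_map_iff'.2 ?_))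
    rw [tendsto_uniformity_iff_dist_tendsto_zero]
    have hle : nhdsWithin x G ×ˢ nhdsWithin x G ≤ nhds (x, x) := by
      rw [nhds_prod_eq]
      exact Filter.prod_mono nhdsWithin_le_nhds nhdsWithin_le_nhds
    have hmem : ∀ᶠ a in nhdsWithin x G, a ∈ U ∩ G := by
      rw [Set.inter_comm]
      exact inter_mem_nhdsWithin G (hU.mem_nhds hxU)
    refine squeeze_zero' (Filter.Eventually.of_forall fun _ => dist_nonneg) ?_
      ((hpow C x).mono_left hle)
    filter_upwards [hmem.prod_mk hmem] with p hp
    exact hC _ hp.1 _ hp.2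
  have hext : ∀ x ∈ Ω, ∃ U : Set Plane, IsOpen U ∧ x ∈ U ∧ ∃ C : ℝ, ∀ a ∈ U ∩ Ω, ∀ b ∈ U ∩ Ω,
      |extendFrom G u a - extendFrom G u b| ≤ C * dist a b ^ α := by
    intro x hx
    obtain ⟨U, hU, hxU, C, hC⟩ := hloc x hx
    refine ⟨U, hU, hxU, C, fun a ha b hb => ?_⟩
    have := hne a
    have := hne b
    have hmem : ∀ c ∈ U, ∀ᶠ d in nhdsWithin c G, d ∈ U ∩ G := fun c hc => by
      rw [Set.inter_comm]
      exact inter_mem_nhdsWithin G (hU.mem_nhds hc)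
    have h1 : Filter.Tendsto (fun p : Plane × Plane => |u p.1 - u p.2|)
        (nhdsWithin a G ×ˢ nhdsWithin b G)
        (nhds |extendFrom G u a - extendFrom G u b|) :=
      (((hlim a ha.2).comp Filter.tendsto_fst).sub ((hlim b hb.2).comp Filter.tendsto_snd)).abs
    have h2 : Filter.Tendsto (fun p : Plane × Plane => C * dist p.1 p.2 ^ α)
        (nhdsWithin a G ×ˢ nhdsWithin b G) (nhds (C * dist a b ^ α)) := by
      have hc : Continuous fun p : Plane × Plane => C * dist p.1 p.2 ^ α :=
        continuous_const.mul ((continuous_fst.dist continuous_snd).rpow_const fun _ => Or.inr hα.le)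
      have := hc.tendsto (a, b)
      rw [nhds_prod_eq] at this
      exact this.mono_left (Filter.prod_mono nhdsWithin_le_nhds nhdsWithin_le_nhds)
    refine le_of_tendsto_of_tendsto h1 h2 ?_
    filter_upwards [(hmem a ha.1).prod_mk (hmem b hb.1)] with p hp
    exact hC _ hp.1 _ hp.2
  have hcont : ContinuousOn (extendFrom G u) Ω := by
    intro x hx
    obtain ⟨U, hU, hxU, C, hC⟩ := hext x hx
    rw [ContinuousWithinAt, tendsto_iff_dist_tendsto_zero]
    have hc : Filter.Tendsto (fun y : Plane => C * dist y x ^ α) (nhdsWithin x Ω) (nhds 0) := by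
      have hc : Continuous fun y : Plane => C * dist y x ^ α :=
        continuous_const.mul
          ((continuous_id.dist continuous_const).rpow_const fun _ => Or.inr hα.le)
      simpa [Real.zero_rpow hα.ne'] using (hc.tendsto x).mono_left nhdsWithin_le_nhds
    refine squeeze_zero' (Filter.Eventually.of_forall fun _ => dist_nonneg) ?_ hc
    filter_upwards [inter_mem_nhdsWithin Ω (hU.mem_nhds hxU)] with y hy
    exact hC _ ⟨hy.2, hy.1⟩ _ ⟨hxU, hx⟩
  refine ⟨extendFrom G u, ?_, fun K hK hKΩ => ?_⟩
  · refine (ae_restrict_iff' hΩ).2 ?_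
    filter_upwards [hGae] with x hxG hx
    have h1 := hlim x hx
    by_contra hcon
    obtain ⟨U, hU, hxU, C, hC⟩ := hloc x hx
    refine hcon (extendFrom_eq (hGdense x) ?_)
    rw [tendsto_iff_dist_tendsto_zero]
    have hc : Filter.Tendsto (fun y : Plane => C * dist y x ^ α) (nhdsWithin x G) (nhds 0) := by
      have hc : Continuous fun y : Plane => C * dist y x ^ α :=
        continuous_const.mul
          ((continuous_id.dist continuous_const).rpow_const fun _ => Or.inr hα.le)
      simpa [Real.zero_rpow hα.ne'] using (hc.tendsto x).mono_left nhdsWithin_le_nhds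
    refine squeeze_zero' (Filter.Eventually.of_forall fun _ => dist_nonneg) ?_ hc
    filter_upwards [inter_mem_nhdsWithin G (hU.mem_nhds hxU)] with y hy
    exact hC _ ⟨hy.2, hy.1⟩ _ ⟨hxU, hxG⟩
  -- Compactness of the product: near a diagonal point the local Hölder bound applies, and near an
  -- off-diagonal point the Hölder quotient is continuous, hence locally bounded.
  · have key : ∃ C : ℝ, ∀ p ∈ K ×ˢ K,
        |extendFrom G u p.1 - extendFrom G u p.2| ≤ C * dist p.1 p.2 ^ α := by
      refine (hK.prod hK).induction_on (p := fun s => ∃ C : ℝ, ∀ p ∈ s,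
        |extendFrom G u p.1 - extendFrom G u p.2| ≤ C * dist p.1 p.2 ^ α) ⟨0, by simp⟩ ?_ ?_ ?_
      · rintro s t hst ⟨C, hC⟩
        exact ⟨C, fun p hp => hC p (hst hp)⟩
      · rintro s t ⟨C, hC⟩ ⟨C', hC'⟩
        refine ⟨max C C', fun p hp => ?_⟩
        have hd : 0 ≤ dist p.1 p.2 ^ α := Real.rpow_nonneg dist_nonneg _
        rcases hp with hp | hp
        · exact (hC p hp).trans (mul_le_mul_of_nonneg_right (le_max_left _ _) hd)
        · exact (hC' p hp).trans (mul_le_mul_of_nonneg_right (le_max_right _ _) hd)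
      · rintro ⟨x, y⟩ ⟨hx, hy⟩
        simp only at hx hy
        rcases eq_or_ne x y with rfl | hxy
        · obtain ⟨U, hU, hxU, C, hC⟩ := hext x (hKΩ hx)
          refine ⟨(K ×ˢ K) ∩ (U ×ˢ U), inter_mem_nhdsWithin _
            ((hU.prod hU).mem_nhds ⟨hxU, hxU⟩), C, fun p hp => ?_⟩
          exact hC _ ⟨hp.2.1, hKΩ hp.1.1⟩ _ ⟨hp.2.2, hKΩ hp.1.2⟩
        · have hd : 0 < dist x y := dist_pos.2 hxy
          have hcx : Filter.Tendsto (extendFrom G u) (nhdsWithin x K)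
              (nhds (extendFrom G u x)) := (hcont.mono hKΩ) x hx
          have hcy : Filter.Tendsto (extendFrom G u) (nhdsWithin y K)
              (nhds (extendFrom G u y)) := (hcont.mono hKΩ) y hy
          have hdt : Filter.Tendsto (fun p : Plane × Plane => dist p.1 p.2)
              (nhdsWithin (x, y) (K ×ˢ K)) (nhds (dist x y)) :=
            ((continuous_fst.dist continuous_snd).tendsto (x, y)).mono_left nhdsWithin_le_nhds
          have hq : Filter.Tendsto (fun p : Plane × Plane =>
              |extendFrom G u p.1 - extendFrom G u p.2| / dist p.1 p.2 ^ α)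
              (nhdsWithin (x, y) (K ×ˢ K))
              (nhds (|extendFrom G u x - extendFrom G u y| / dist x y ^ α)) := by
            refine Filter.Tendsto.div ?_ (hdt.rpow_const (Or.inr hα.le))
              (Real.rpow_pos_of_pos hd _).ne'
            rw [nhdsWithin_prod_eq]
            exact ((hcx.comp Filter.tendsto_fst).sub (hcy.comp Filter.tendsto_snd)).abs
          refine ⟨_, (hq.eventually (eventually_lt_nhds (lt_add_one _))).and
            (hdt.eventually (eventually_gt_nhds hd)),
            |extendFrom G u x - extendFrom G u y| / dist x y ^ α + 1, fun p hp => ?_⟩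
          have hp' := hp.1.le
          rwa [div_le_iff₀ (Real.rpow_pos_of_pos hp.2 _)] at hp'
    obtain ⟨C, hC⟩ := key
    exact ⟨C, fun x hx y hy => hC (x, y) ⟨hx, hy⟩⟩

/-! ### Positivity, finiteness and use of the number S -/

/-- Boundedness ensures that the frontier is nonempty; `Metric.infDist` to the empty set would be
$0$. -/
theorem infDist_frontier_pos {Ω : Set Plane} (hΩ : IsOpen Ω) (hΩb : Bornology.IsBounded Ω)
    {x : Plane} (hx : x ∈ Ω) : 0 < Metric.infDist x (frontier Ω) := by
  have hne : (frontier Ω).Nonempty := nonempty_frontier_iff.2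
    ⟨⟨x, hx⟩, fun h => NormedSpace.unbounded_univ ℝ Plane (h ▸ hΩb)⟩
  refine (isClosed_frontier.notMem_iff_infDist_pos hne).1 fun hxf => ?_
  rw [hΩ.frontier_eq] at hxf
  exact hxf.2 hx

/-- A nearest point of the complement lies on the frontier, so the distance to the frontier is at
most the distance to the complement. -/
theorem ball_infDist_frontier_subset {Ω : Set Plane} (hΩb : Bornology.IsBounded Ω)
    {x : Plane} (hx : x ∈ Ω) : Metric.ball x (Metric.infDist x (frontier Ω)) ⊆ Ω := by
  obtain ⟨y, hy, hxy⟩ := exists_mem_frontier_infDist_compl_eq_dist hx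
    fun h => NormedSpace.unbounded_univ ℝ Plane (h ▸ hΩb)
  exact (Metric.ball_subset_ball ((Metric.infDist_le_dist_of_mem hy).trans hxy.ge)).trans
    Metric.ball_infDist_compl_subset

theorem le_infDist_frontier {Ω : Set Plane} (hΩ : IsOpen Ω) (hΩb : Bornology.IsBounded Ω)
    {x : Plane} (hx : x ∈ Ω) {R : ℝ} (hR : Metric.ball x R ⊆ Ω) :
    R ≤ Metric.infDist x (frontier Ω) := by
  have hne : (frontier Ω).Nonempty := nonempty_frontier_iff.2
    ⟨⟨x, hx⟩, fun h => NormedSpace.unbounded_univ ℝ Plane (h ▸ hΩb)⟩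
  refine (Metric.le_infDist hne).2 fun y hy => ?_
  by_contra! hlt
  rw [hΩ.frontier_eq] at hy
  exact hy.2 (hR (by rwa [Metric.mem_ball, dist_comm]))

theorem polar_mem_ball (x : Plane) {r R : ℝ} (hr : r ∈ Set.Ioo 0 R) (θ : ℝ) :
    x + r • circlePoint θ ∈ Metric.ball x R := by
  rw [Metric.mem_ball, dist_eq_norm, add_sub_cancel_left, norm_smul, norm_circlePoint, mul_one,
    Real.norm_eq_abs, abs_of_pos hr.1]
  exact hr.2

theorem circleIntegralForm_le {A : CoeffField} {lam Lam : ℝ} {x₀ : Plane} {R : ℝ}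
    (h : IsEllipticOn A lam Lam (Metric.ball x₀ R)) {r : ℝ} (hr : r ∈ Set.Ioo 0 R) :
    circleIntegralForm A x₀ r ≤ ENNReal.ofReal Lam * ENNReal.ofReal (2 * Real.pi) := by
  calc circleIntegralForm A x₀ r
      ≤ ∫⁻ _ in Set.Ioc 0 (2 * Real.pi), ENNReal.ofReal Lam := by
        refine lintegral_mono fun θ => ENNReal.ofReal_le_ofReal ?_
        simpa [norm_circlePoint] using
          (h.bounds _ (polar_mem_ball x₀ hr θ) (circlePoint θ)).2
    _ = _ := by simp [Real.volume_Ioc]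

theorem le_circleIntegralForm {A : CoeffField} {lam Lam : ℝ} {x₀ : Plane} {R : ℝ}
    (h : IsEllipticOn A lam Lam (Metric.ball x₀ R)) {r : ℝ} (hr : r ∈ Set.Ioo 0 R) :
    ENNReal.ofReal lam * ENNReal.ofReal (2 * Real.pi) ≤ circleIntegralForm A x₀ r := by
  calc ENNReal.ofReal lam * ENNReal.ofReal (2 * Real.pi)
      = ∫⁻ _ in Set.Ioc 0 (2 * Real.pi), ENNReal.ofReal lam := by simp [Real.volume_Ioc]
    _ ≤ circleIntegralForm A x₀ r := by
        refine lintegral_mono fun θ => ENNReal.ofReal_le_ofReal ?_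
        simpa [norm_circlePoint] using
          (h.bounds _ (polar_mem_ball x₀ hr θ) (circlePoint θ)).1

theorem supCircleIntegral_ne_top {Ω : Set Plane} (hΩb : Bornology.IsBounded Ω) {A : CoeffField}
    {lam Lam : ℝ} (h : IsEllipticOn A lam Lam Ω) : supCircleIntegral Ω A ≠ ⊤ := by
  refine ne_top_of_le_ne_top (b := ENNReal.ofReal Lam * ENNReal.ofReal (2 * Real.pi))
    (ENNReal.mul_ne_top ENNReal.ofReal_ne_top ENNReal.ofReal_ne_top) (iSup₂_le fun x hx => ?_)
  refine essSup_le_of_ae_le _ ?_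
  filter_upwards [ae_restrict_mem measurableSet_Ioo] with r hr
  exact circleIntegralForm_le (h.mono (ball_infDist_frontier_subset hΩb hx)) hr

theorem supCircleIntegral_ne_zero {Ω : Set Plane} (hΩ : IsOpen Ω) (hΩb : Bornology.IsBounded Ω)
    (hΩn : Ω.Nonempty) {A : CoeffField} {lam Lam : ℝ} (h : IsEllipticOn A lam Lam Ω) :
    supCircleIntegral Ω A ≠ 0 := by
  obtain ⟨x, hx⟩ := hΩn
  have hd := infDist_frontier_pos hΩ hΩb hx
  have hpos : 0 < ENNReal.ofReal lam * ENNReal.ofReal (2 * Real.pi) :=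
    ENNReal.mul_pos (ENNReal.ofReal_pos.2 h.pos).ne'
      (ENNReal.ofReal_pos.2 Real.two_pi_pos).ne'
  refine (hpos.trans_le ?_).ne'
  refine le_trans ?_ (le_iSup₂ (f := fun x₀ (_ : x₀ ∈ Ω) =>
    essSup (fun r : ℝ => circleIntegralForm A x₀ r)
      (volume.restrict (Set.Ioo 0 (Metric.infDist x₀ (frontier Ω))))) x hx)
  -- The essential supremum of a constant is that constant only for a nonzero measure, so the
  -- interval of radii must be nonempty.
  have hμ : volume.restrict (Set.Ioo 0 (Metric.infDist x (frontier Ω))) ≠ 0 := by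
    rw [Ne, Measure.restrict_eq_zero, Real.volume_Ioo]
    simpa using hd
  rw [← essSup_const (ENNReal.ofReal lam * ENNReal.ofReal (2 * Real.pi)) hμ]
  refine essSup_mono_ae ?_
  filter_upwards [ae_restrict_mem measurableSet_Ioo] with r hr
  exact le_circleIntegralForm (h.mono (ball_infDist_frontier_subset hΩb hx)) hr

/-- Translates the extended-valued supremum into the real bound used in the energy estimates. A disc
inside `Ω` has radius at most the distance to the frontier, so its radii are among those over which
the essential supremum is taken. -/
theorem ae_integral_quadForm_le {Ω : Set Plane} (hΩ : IsOpen Ω) (hΩb : Bornology.IsBounded Ω)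
    {A : CoeffField} {lam Lam : ℝ} (h : IsEllipticOn A lam Lam Ω) {x : Plane} (hx : x ∈ Ω)
    {R : ℝ} (hR : Metric.ball x R ⊆ Ω) :
    ∀ᵐ r ∂volume.restrict (Set.Ioo 0 R),
      ∫ θ in Set.Ioc 0 (2 * Real.pi), quadForm A (x + r • circlePoint θ) (circlePoint θ)
        ≤ (supCircleIntegral Ω A).toReal := by
  have h1 : ∀ᵐ r ∂volume.restrict (Set.Ioo 0 R),
      circleIntegralForm A x r ≤ supCircleIntegral Ω A := by
    refine ae_restrict_of_ae_restrict_of_subset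
      (Set.Ioo_subset_Ioo_right (le_infDist_frontier hΩ hΩb hx hR)) ?_
    filter_upwards [ENNReal.ae_le_essSup (fun r : ℝ => circleIntegralForm A x r)] with r hr
    exact hr.trans (le_iSup₂ (f := fun x₀ (_ : x₀ ∈ Ω) =>
      essSup (fun r : ℝ => circleIntegralForm A x₀ r)
        (volume.restrict (Set.Ioo 0 (Metric.infDist x₀ (frontier Ω))))) x hx)
  filter_upwards [h1, ae_restrict_mem measurableSet_Ioo] with r hr hrR
  by_cases hi : IntegrableOn (fun θ => quadForm A (x + r • circlePoint θ) (circlePoint θ))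
      (Set.Ioc 0 (2 * Real.pi))
  · rw [integral_eq_lintegral_of_nonneg_ae _ hi.aestronglyMeasurable]
    · exact ENNReal.toReal_mono (supCircleIntegral_ne_top hΩb h) hr
    · refine Filter.Eventually.of_forall fun θ => ?_
      exact le_trans (by have := h.pos; positivity)
        (h.bounds _ (hR (polar_mem_ball x hrR θ)) (circlePoint θ)).1
  -- On a circle where the form is not integrable the Bochner integral is $0$ by convention, and the
  -- bound is trivial.
  · rw [integral_undef hi]
    exact ENNReal.toReal_nonneg

/-! ### Localisation and conclusion -/

theorem IsTestFunction.mono {U Ω : Set Plane} (hU : U ⊆ Ω) {φ : Plane → ℝ}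
    (h : IsTestFunction U φ) : IsTestFunction Ω φ :=
  ⟨h.smooth, h.compact_support, h.support_subset.trans hU⟩

theorem setIntegral_flux_eq_zero {Ω : Set Plane} (hΩ : MeasurableSet Ω) {A : CoeffField}
    {Du : Fin 2 → Plane → ℝ}
    (hsol : ∀ φ : Plane → ℝ, IsTestFunction Ω φ →
      ∫ x in Ω, ∑ i, ∑ j, A x i j * Du i x * classicalPartial j φ x = 0)
    {U : Set Plane} (hU : U ⊆ Ω) {φ : Plane → ℝ} (hφ : IsTestFunction U φ) :
    ∫ x in U, ∑ j, flux A Du j x * classicalPartial j φ x = 0 := by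
  have hsupp : ∀ x ∉ U, ∀ j, classicalPartial j φ x = 0 := by
    intro x hx j
    have : x ∉ tsupport (fderiv ℝ φ) := fun hx' =>
      hx (hφ.support_subset (tsupport_fderiv_subset ℝ hx'))
    simp [classicalPartial, image_eq_zero_of_notMem_tsupport this]
  rw [← setIntegral_eq_of_subset_of_forall_sdiff_eq_zero hΩ hU fun x hx => by
    simp [hsupp x hx.2], ← hsol φ (hφ.mono hU)]
  refine integral_congr_ae (Filter.Eventually.of_forall fun x => ?_)
  simp only [flux, Fin.sum_univ_two]
  ring

theorem MemL2Loc.memLp_ball {Ω : Set Plane} {f : Plane → ℝ} (hf : MemL2Loc Ω f) {z : Plane}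
    {R : ℝ} (hR : Metric.closedBall z R ⊆ Ω) : MemLp f 2 (volume.restrict (Metric.ball z R)) :=
  (hf _ (isCompact_closedBall z R) hR).mono_measure
    (Measure.restrict_mono_set _ Metric.ball_subset_closedBall)

/-- An energy bound on a disc controls the `L²` norms of the gradient components. -/
theorem eLpNorm_closedBall_le_of_energy {A : CoeffField} {lam Lam : ℝ} {p : Plane} {t : ℝ}
    (h : IsEllipticOn A lam Lam (Metric.ball p t)) {V : Fin 2 → Plane → ℝ}
    (hV : ∀ i, MemLp (V i) 2 (volume.restrict (Metric.ball p t))) {C : ℝ} (hC : 0 ≤ C)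
    (hE : ∫ x in Metric.ball p t, energyDensity A V x ≤ lam * C ^ 2) (i : Fin 2) :
    eLpNorm (V i) 2 (volume.restrict (Metric.closedBall p t)) ≤ ENNReal.ofReal C := by
  have hae : (Metric.closedBall p t : Set Plane) =ᵐ[volume] Metric.ball p t := by
    refine (Filter.EventuallyEq.symm ?_)
    refine ae_eq_of_subset_of_measure_ge Metric.ball_subset_closedBall
      (Measure.addHaar_closedBall_eq_addHaar_ball volume p t).le ?_ ?_
    · exact Metric.isOpen_ball.measurableSet.nullMeasurableSet
    · exact (isCompact_closedBall p t).measure_lt_top.ne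
  rw [Measure.restrict_congr_set hae]
  refine (ENNReal.pow_le_pow_left_iff two_ne_zero).1 ?_
  rw [eLpNorm_two_pow, ← ENNReal.ofReal_pow hC]
  have hsq : Integrable (fun x => V i x ^ 2) (volume.restrict (Metric.ball p t)) :=
    (hV i).integrable_sq
  have h1 : ∫⁻ x in Metric.ball p t, ‖V i x‖ₑ ^ 2
      = ENNReal.ofReal (∫ x in Metric.ball p t, V i x ^ 2) := by
    rw [ofReal_integral_eq_lintegral_ofReal hsq (Filter.Eventually.of_forall fun x => sq_nonneg _)]
    refine lintegral_congr fun x => ?_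
    rw [Real.enorm_eq_ofReal_abs, ← ENNReal.ofReal_pow (abs_nonneg _), sq_abs]
  rw [h1]
  refine ENNReal.ofReal_le_ofReal ?_
  refine le_of_mul_le_mul_left ?_ h.pos
  refine le_trans ?_ hE
  rw [← integral_const_mul]
  refine setIntegral_mono_on (hsq.const_mul _)
    (integrableOn_energyDensity Metric.isOpen_ball.measurableSet h hV)
    Metric.isOpen_ball.measurableSet fun x hx => ?_
  refine le_trans (mul_le_mul_of_nonneg_left ?_ h.pos.le) (le_energyDensity h hx V)
  exact Finset.single_le_sum (f := fun i => V i x ^ 2) (fun j _ => sq_nonneg _)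
    (Finset.mem_univ i)

theorem exists_local_holder_bound {Ω : Set Plane} (hΩ : IsOpen Ω) (hΩb : Bornology.IsBounded Ω)
    {A : CoeffField} {lam Lam : ℝ} (h : IsEllipticOn A lam Lam Ω) {u : Plane → ℝ}
    (hu : IsWeakSolution Ω A u) (hS : 0 < (supCircleIntegral Ω A).toReal) {z : Plane}
    (hz : z ∈ Ω) :
    ∃ ρ > 0, ∃ C : ℝ, ∃ N : Set Plane, volume N = 0 ∧
      ∀ x ∈ Metric.ball z ρ \ N, ∀ y ∈ Metric.ball z ρ \ N,
        |u x - u y| ≤ C * dist x y ^ holderExponent Ω A := by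
  obtain ⟨huL, Du, hDu, hsol⟩ := hu
  obtain ⟨ε, hε, hεΩ⟩ := Metric.nhds_basis_closedBall.mem_iff.1 (hΩ.mem_nhds hz)
  -- Discs of radius `ρ` centred in `ball z ρ` stay in `ball z (3 * ρ)`, and `3 * ρ < ε` leaves room
  -- for mollification.
  set ρ := ε / 4 with hρdef
  have hρ : 0 < ρ := by positivity
  set S := (supCircleIntegral Ω A).toReal with hSdef
  set α := holderExponent Ω A with hαdef
  have hαS : α = 2 * Real.pi / S := by rw [hαdef, holderExponent, div_eq_mul_inv]
  have hα : 0 < α := by rw [hαS]; positivity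
  have h3ε : Metric.closedBall z (3 * ρ) ⊆ Ω :=
    (Metric.closedBall_subset_closedBall (by rw [hρdef]; linarith)).trans hεΩ
  have hbΩ : Metric.ball z (3 * ρ) ⊆ Ω := Metric.ball_subset_closedBall.trans h3ε
  obtain ⟨w, hw, hwu, hwD⟩ := exists_smooth_approx huL hDu (x₀ := z) (R := 3 * ρ) (R₁ := ε)
    (by rw [hρdef]; linarith) hεΩ
  have hum := huL.memLp_ball h3ε
  have hVm := fun i => (hDu.memL2Loc i).memLp_ball h3ε
  have hell3 := h.mono hbΩ
  have hmeas3 : MeasurableSet (Metric.ball z (3 * ρ)) := Metric.isOpen_ball.measurableSet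
  have hEnn : ∀ x ∈ Metric.ball z (3 * ρ), 0 ≤ energyDensity A Du x := fun x hx =>
    le_trans (mul_nonneg h.pos.le (Finset.sum_nonneg fun _ _ => sq_nonneg _))
      (le_energyDensity hell3 hx Du)
  set E := ∫ x in Metric.ball z (3 * ρ), energyDensity A Du x with hE
  have hE0 : 0 ≤ E := setIntegral_nonneg hmeas3 hEnn
  -- Chosen so that $\lambda(Ct^\alpha)^2=(t/\rho)^{2\alpha}E$. It does not depend on the centre
  -- `p`, since every disc `ball p ρ` has energy at most `E`.
  set C := √(E / lam) * (ρ ^ α)⁻¹ with hC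
  have hC0 : 0 ≤ C := by positivity
  have hdec : ∀ p ∈ Metric.ball z ρ, ∀ t, 0 < t → t ≤ ρ → ∀ i,
      eLpNorm (Du i) 2 (volume.restrict (Metric.closedBall p t))
        ≤ ENNReal.ofReal (C * t ^ α) := by
    intro p hp t ht htρ i
    have hpsub : Metric.ball p ρ ⊆ Metric.ball z (3 * ρ) :=
      Metric.ball_subset_ball' (by rw [Metric.mem_ball] at hp; linarith)
    have hpt : Metric.ball p t ⊆ Metric.ball p ρ := Metric.ball_subset_ball htρ
    have hres : volume.restrict (Metric.ball p ρ) ≤ volume.restrict (Metric.ball z (3 * ρ)) :=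
      Measure.restrict_mono_set _ hpsub
    have hdecay := setIntegral_energyDensity_le_rpow (hell3.mono hpsub) (V := Du)
      (fun i => (hVm i).mono_measure hres)
      (fun φ hφ => setIntegral_flux_eq_zero hΩ.measurableSet hsol (hpsub.trans hbΩ) hφ) hS
      (ae_integral_quadForm_le hΩ hΩb h (hbΩ (hpsub (Metric.mem_ball_self hρ)))
        (hpsub.trans hbΩ)) hw
      (fun i => tendsto_of_tendsto_of_tendsto_of_le_of_le tendsto_const_nhds (hwD i)
        (fun _ => zero_le) fun n => eLpNorm_mono_measure _ hres) ht htρ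
    refine eLpNorm_closedBall_le_of_energy (hell3.mono (hpt.trans hpsub))
      (fun i => (hVm i).mono_measure (Measure.restrict_mono_set _ (hpt.trans hpsub)))
      (by positivity) ?_ i
    have hEp : ∫ x in Metric.ball p ρ, energyDensity A Du x ≤ E :=
      setIntegral_mono_set (integrableOn_energyDensity hmeas3 hell3 hVm)
        ((ae_restrict_iff' hmeas3).2 (Filter.Eventually.of_forall hEnn)) hpsub.eventuallyLE
    refine hdecay.trans ((mul_le_mul_of_nonneg_left hEp (by positivity)).trans_eq ?_)
    -- The energy is quadratic in the gradient, so its decay exponent is twice the Hölder exponent.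
    have hexp : (4 * Real.pi / S) = α + α := by rw [hαS]; ring
    have hlam := h.pos
    rw [hexp, Real.rpow_add (by positivity), Real.div_rpow ht.le hρ.le, hC, mul_pow, mul_pow,
      Real.sq_sqrt (by positivity)]
    have := (Real.rpow_pos_of_pos hρ α).ne'
    field_simp
  obtain ⟨N, hN, hbd⟩ := exists_null_abs_sub_le (by linarith) hw hum hVm hwu hwD hα hC0 hdec
  exact ⟨ρ, hρ, _, N, hN, hbd⟩

end

theorem theorem2 (Ω : Set Plane) (hΩ : IsOpen Ω) (hΩb : Bornology.IsBounded Ω)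
    (hΩn : Ω.Nonempty) (A : CoeffField)
    (hmeas : ∀ i j, AEMeasurable (fun x => A x i j) (volume.restrict Ω))
    (lam Lam : ℝ) (hlam : 0 < lam) (hlamLam : lam ≤ Lam)
    (hell : ∀ x ∈ Ω, ∀ ξ : Plane,
      lam * ‖ξ‖ ^ 2 ≤ quadForm A x ξ ∧ quadForm A x ξ ≤ Lam * ‖ξ‖ ^ 2)
    (hsymm : ∀ x ∈ Ω, ∀ i j, A x i j = A x j i)
    (hdet : ∀ x ∈ Ω, (A x).det = 1)
    (u : Plane → ℝ) (hu : IsWeakSolution Ω A u) :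
    supCircleIntegral Ω A ≠ 0 ∧ supCircleIntegral Ω A ≠ ⊤ ∧
      IsLocallyHolder Ω (holderExponent Ω A) u := by
  have h : IsEllipticOn A lam Lam Ω := ⟨hlam, hmeas, hell, hsymm, hdet⟩
  have h0 := supCircleIntegral_ne_zero hΩ hΩb hΩn h
  have h1 := supCircleIntegral_ne_top hΩb h
  have hS := ENNReal.toReal_pos h0 h1
  refine ⟨h0, h1, isLocallyHolder_of_local_bounds ?_ hΩ.measurableSet fun z hz =>
    exists_local_holder_bound hΩ hΩb h hu hS hz⟩
  rw [holderExponent]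
  positivity
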